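/- Let $n$ be a natural number, let $K\subset\mathbb{R}^n$ be a closed convex set and let $\mu_0\in K$. For $h\in\mathbb{R}^n$ and $\sigma>0$ put $y=\mu_0+\sigma h$, let $\Pi_K$ be the Euclidean projection onto $K$, and let $\hat\mu(\sigma)=\Pi_K(y)=\operatorname{argmin}_{\mu\in K}\|y-\mu\|^2$. Define $$\mathrm{err}(\sigma)=\|\hat\mu(\sigma)-\mu_0\|^2,\qquad \mathrm{lrt}(\sigma)=\|y-\mu_0\|^2-\|y-\hat\mu(\sigma)\|^2 ,$$ and let $\operatorname{div}\hat\mu(\sigma)=\sum_{i=1}^n \partial (\Pi_K)_i(y)/\partial y_i$ be the divergence of $\Pi_K$ at $y$, which is defined for almost every $y$. Probabilities, expectations and variances are taken with $h\sim N(0,I_n)$. All expectations below are finite (the exponential moment under its stated condition on $\lambda$), and for every $\sigma>0$ the following hold. 1. $\mathbb{E}\,\mathrm{lrt}(\sigma)\le 2\sigma^2\,\mathbb{E}\operatorname{div}\hat\mu(\sigma)\le 2\sigma^2 n$. 2. For every $h\in\mathbb{R}^n$, the integral below converges and $$\mathrm{err}(\sigma)\le \mathrm{lrt}(\sigma)\le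 \mathrm{err}(\sigma)+2\sigma\int_0^\sigma\Big(\frac{\mathrm{err}(\tau)}{\tau^2}-\frac{\mathrm{err}(\sigma)}{\sigma^2}\Big)\,d\tau .$$ If moreover $K$ is a closed convex cone, then for every $h\in\mathbb{R}^n$ and every (possibly random, that is, depending on $h$) $\nu\in\mathbb{R}^n$ such that $K+\nu\subset K$ and $\hat\mu(\sigma)-\nu\in K$, $$\mathrm{err}(\sigma)\le \mathrm{lrt}(\sigma)\le \mathrm{err}(\sigma)+2\langle \hat\mu(\sigma)-\mu_0-\sigma h,\ \mu_0-\nu\rangle ;$$ the vector $\nu=\hat\mu(\sigma)$ satisfies these conditions, and for it the right-hand inequality is an equality. 3. $\operatorname{Var}(\mathrm{lrt}(\sigma))\le 4\sigma^2\,\mathbb{E}\,\mathrm{err}(\sigma)$. 4. For every $\lambda\in\mathbb{R}$ with $\lambda^2<\mathbb{E}\,\mathrm{err}(\sigma)/(8\sigma^2)$, $$\mathbb{E}\exp\Big[\lambda\cdot\frac{\mathrm{lrt}(\sigma)-\mathbb{E}\,\mathrm{lrt}(\sigma)}{\sigma\,(\mathbb{E}\,\mathrm{err}(\sigma))^{1/2}}\Big]\le\exp\Big(\frac{4\lambda^2}{1-8\big(\sigma^2/\mathbb{E}\,\mathrm{err}(\sigma)\big)\lambda^2}\Big).$$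 Moreover, there is an absolute constant $L>0$ (independent of $n,K,\mu_0,\sigma,t$) such that for all $t\ge 0$ $$\mathbb{P}\Big(L^{-1}\big|\mathrm{lrt}(\sigma)-\mathbb{E}\,\mathrm{lrt}(\sigma)\big|\ge\sqrt{\sigma^2\cdot\mathbb{E}\,\mathrm{err}(\sigma)\cdot t}+\sigma^2 t\Big)\le L\,e^{-t/L}.$$ -/

import Mathlib

open MeasureTheory ProbabilityTheory

namespace SeqModel

/-- `p` is a minimizer of `μ ↦ ‖y - μ‖²` over `μ ∈ K`, for the Euclidean norm. -/
def IsLeastSquares {n : ℕ} (K : Set (EuclideanSpace ℝ (Fin n)))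
    (y p : EuclideanSpace ℝ (Fin n)) : Prop :=
  p ∈ K ∧ ∀ q ∈ K, ‖y - p‖ ^ 2 ≤ ‖y - q‖ ^ 2

/-- Over a nonempty closed convex set the least squares problem has exactly one solution. -/
theorem existsUnique_isLeastSquares {n : ℕ} {K : Set (EuclideanSpace ℝ (Fin n))}
    (hc : IsClosed K) (hK : Convex ℝ K) (hne : K.Nonempty) (y : EuclideanSpace ℝ (Fin n)) :
    ∃! p, IsLeastSquares K y p := by
  obtain ⟨p, hp, hmin⟩ := exists_norm_eq_iInf_of_complete_convex hne hc.isComplete hK y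
  have hbdd : BddBelow (Set.range fun w : K => ‖y - w‖) :=
    ⟨0, by rintro _ ⟨w, rfl⟩; exact norm_nonneg _⟩
  have hle : ∀ q ∈ K, ‖y - p‖ ≤ ‖y - q‖ := fun q hq => by
    rw [hmin]; exact ciInf_le hbdd ⟨q, hq⟩
  refine ⟨p, ⟨hp, fun q hq => pow_le_pow_left₀ (norm_nonneg _) (hle q hq) 2⟩, ?_⟩
  rintro q ⟨hq, hqmin⟩
  have h1 := (norm_eq_iInf_iff_real_inner_le_zero hK hp).1 hmin q hq
  have h2 := hqmin p hp
  have h3 : ‖y - q‖ ^ 2 = ‖y - p‖ ^ 2 - 2 * inner ℝ (y - p) (q - p) + ‖q - p‖ ^ 2 := by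
    rw [← norm_sub_sq_real]; congr 2; abel
  have h4 : ‖q - p‖ ^ 2 ≤ 0 := by linarith
  have h5 : ‖q - p‖ = 0 := by
    have := norm_nonneg (q - p)
    nlinarith
  exact sub_eq_zero.1 (norm_eq_zero.1 h5)

open Classical in
/-- The projection `y ↦ argmin_{μ ∈ K} ‖y - μ‖²` onto `K`; it is meant for nonempty closed convex
`K`, where the minimizer exists and is unique. -/
noncomputable def proj {n : ℕ} (K : Set (EuclideanSpace ℝ (Fin n)))
    (y : EuclideanSpace ℝ (Fin n)) : EuclideanSpace ℝ (Fin n) :=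
  if h : ∃ p, IsLeastSquares K y p then h.choose else 0

theorem isLeastSquares_iff_eq_proj {n : ℕ} {K : Set (EuclideanSpace ℝ (Fin n))}
    (hc : IsClosed K) (hK : Convex ℝ K) (hne : K.Nonempty) (y p : EuclideanSpace ℝ (Fin n)) :
    IsLeastSquares K y p ↔ p = proj K y := by
  have hu := existsUnique_isLeastSquares hc hK hne y
  have hs : IsLeastSquares K y (proj K y) := by
    rw [proj, dif_pos hu.exists]; exact hu.exists.choose_spec
  exact ⟨fun h => hu.unique h hs, fun h => h ▸ hs⟩

/-- The observation `y = μ₀ + σ h` of the Gaussian sequence model, with noise `h`. -/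
noncomputable def obs {n : ℕ} (μ₀ : EuclideanSpace ℝ (Fin n)) (σ : ℝ)
    (h : EuclideanSpace ℝ (Fin n)) : EuclideanSpace ℝ (Fin n) :=
  μ₀ + σ • h

/-- The convex constrained least squares estimator `μ̂_K(σ)` computed from `y = μ₀ + σ h`. -/
noncomputable def lse {n : ℕ} (K : Set (EuclideanSpace ℝ (Fin n)))
    (μ₀ : EuclideanSpace ℝ (Fin n)) (σ : ℝ) (h : EuclideanSpace ℝ (Fin n)) :
    EuclideanSpace ℝ (Fin n) :=
  proj K (obs μ₀ σ h)

/-- The squared error `‖μ̂_K(σ) - μ₀‖²`. -/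
noncomputable def err {n : ℕ} (K : Set (EuclideanSpace ℝ (Fin n)))
    (μ₀ : EuclideanSpace ℝ (Fin n)) (σ : ℝ) (h : EuclideanSpace ℝ (Fin n)) : ℝ :=
  ‖lse K μ₀ σ h - μ₀‖ ^ 2

/-- The (scaled) log likelihood ratio statistic `‖y - μ₀‖² - ‖y - μ̂_K(σ)‖²`. -/
noncomputable def lrt {n : ℕ} (K : Set (EuclideanSpace ℝ (Fin n)))
    (μ₀ : EuclideanSpace ℝ (Fin n)) (σ : ℝ) (h : EuclideanSpace ℝ (Fin n)) : ℝ :=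
  ‖obs μ₀ σ h - μ₀‖ ^ 2 - ‖obs μ₀ σ h - lse K μ₀ σ h‖ ^ 2

/-- The divergence `∑ᵢ ∂fᵢ/∂zᵢ` of a vector field `f` at `z`. -/
noncomputable def divergence {n : ℕ}
    (f : EuclideanSpace ℝ (Fin n) → EuclideanSpace ℝ (Fin n)) (z : EuclideanSpace ℝ (Fin n)) : ℝ :=
  ∑ i : Fin n, lineDeriv ℝ (fun w => f w i) z (EuclideanSpace.single i 1)

/-- `div μ̂_K(σ)`: the divergence of the estimator, as a function of the observation, evaluated at
`y = μ₀ + σ h`. -/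
noncomputable def divLse {n : ℕ} (K : Set (EuclideanSpace ℝ (Fin n)))
    (μ₀ : EuclideanSpace ℝ (Fin n)) (σ : ℝ) (h : EuclideanSpace ℝ (Fin n)) : ℝ :=
  divergence (proj K) (obs μ₀ σ h)

/-- The law `N(0, Iₙ)` of the noise vector `h`. -/
noncomputable abbrev gauss (n : ℕ) : Measure (EuclideanSpace ℝ (Fin n)) :=
  stdGaussian (EuclideanSpace ℝ (Fin n))

/-- `E err(σ)`. -/
noncomputable def meanErr {n : ℕ} (K : Set (EuclideanSpace ℝ (Fin n)))
    (μ₀ : EuclideanSpace ℝ (Fin n)) (σ : ℝ) : ℝ :=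
  ∫ h, err K μ₀ σ h ∂gauss n

/-- `E lrt(σ)`. -/
noncomputable def meanLrt {n : ℕ} (K : Set (EuclideanSpace ℝ (Fin n)))
    (μ₀ : EuclideanSpace ℝ (Fin n)) (σ : ℝ) : ℝ :=
  ∫ h, lrt K μ₀ σ h ∂gauss n

end SeqModel

/-! Put x = σh, let D(x) = Π_K(μ₀ + x) - μ₀ be the displacement, and let F(x) = ‖x‖² - ‖x - D(x)‖² =
2⟨x, D(x)⟩ - ‖D(x)‖². Then err = ‖D‖² and lrt = F. Optimality of the projection makes F a maximum of
affine functions with subgradient 2D(x). Since D is 1-Lipschitz, F is differentiable everywhere with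
∇F = 2D (`hasFDerivAt_excess`), while ‖∇‖D‖²‖ ≤ 2‖D‖. So f = lrt/σ² and g = err/σ², as functions of
h, satisfy the closed system ‖∇f‖ ≤ 2√g, ‖∇g‖ ≤ 2√g.

This system gives the concentration statements. Let P_θ f(x) be the average of f(cos θ z + sin θ x)
over Gaussian z; it is the constant E f at θ = 0 and f itself at θ = π/2. For 0 ≤ l < 1/2 consider
Φ(θ) = E exp(l P_θ f + a(θ) P_θ g). Gaussian integration by parts turns Φ' into sin θ cos θ times
the expectation of the exponential times ‖l P_θ∇f + a P_θ∇g‖² - 4(l + a)² P_θ g, provided a' = -4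
sin θ cos θ (l + a)². Jensen's inequality and the gradient bounds make this nonpositive. With a(π/2)
= 0, comparing the endpoints gives E exp(l f) ≤ exp(l E f + 2l²/(1 - 2l) E g)
(`integral_exp_mul_stdGaussian_le`). The interpolation is run for Lipschitz f and g, so K is first
intersected with a large ball around μ₀, and Fatou's lemma removes the truncation
(`integral_exp_mul_lrt_le`). The variance bound is the second-order term of the exponential bound at
0, and the tail bound is Chernoff's.

For the mean, lrt + err = 2⟨σh, D(σh)⟩, and Stein's identity gives E lrt = 2σ² E div - E err; each
partial derivative in the divergence is at most 1. Pathwise, (lrt(τ)/τ)' = err(τ)/τ², so lrt(σ) is σ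
times the integral of err(τ)/τ² over [0, σ]. The cone bound is the variational inequality of the
projection at the point μ̂ + (μ̂ - ν) of K. -/

open scoped RealInnerProductSpace NNReal

/-! ### Standard Gaussian measure: null sets, exponential moments, rotation invariance -/

namespace MeasureTheory.Measure

theorem pi_fin_absolutelyContinuous {α : Type*} [MeasurableSpace α] {μ ν : Measure α}
    [SigmaFinite μ] [SigmaFinite ν] (h : μ ≪ ν) (n : ℕ) :
    Measure.pi (fun _ : Fin n => μ) ≪ Measure.pi (fun _ : Fin n => ν) := by
  induction n with
  | zero =>
    rw [Measure.pi_of_empty, Measure.pi_of_empty]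
  | succ n ih =>
    have h1 := (measurePreserving_piFinSuccAbove (fun _ : Fin (n + 1) => μ) 0).symm
    have h2 := (measurePreserving_piFinSuccAbove (fun _ : Fin (n + 1) => ν) 0).symm
    rw [← h1.map_eq, ← h2.map_eq]
    exact (h.prod ih).map (MeasurableEquiv.measurable _)

end MeasureTheory.Measure

namespace ProbabilityTheory

variable {E : Type*} [NormedAddCommGroup E] [InnerProductSpace ℝ E] [FiniteDimensional ℝ E]
  [MeasurableSpace E] [BorelSpace E]

/-- Needed to transfer Rademacher's theorem: Lipschitz functions are differentiable Lebesgue-a.e.,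
hence Gaussian-a.e. -/
theorem stdGaussian_absolutelyContinuous : stdGaussian E ≪ (volume : Measure E) := by
  have h := Measure.pi_fin_absolutelyContinuous
    (gaussianReal_absolutelyContinuous 0 (v := 1) one_ne_zero) (Module.finrank ℝ E)
  have h1 : stdGaussian E =
      (Measure.pi fun _ : Fin (Module.finrank ℝ E) => gaussianReal 0 1).map
        ((stdOrthonormalBasis ℝ E).repr.symm ∘ WithLp.toLp 2) := by
    rw [stdGaussian]
    congr 1
    ext x
    simp [OrthonormalBasis.sum_repr_symm]
  have h2 : MeasurePreserving ((stdOrthonormalBasis ℝ E).repr.symm ∘ WithLp.toLp 2)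
      (volume : Measure (Fin (Module.finrank ℝ E) → ℝ)) volume :=
    (stdOrthonormalBasis ℝ E).measurePreserving_repr_symm.comp
      (PiLp.volume_preserving_toLp _)
  rw [h1, ← h2.map_eq]
  exact h.map h2.measurable

/-- Fernique's theorem gives integrability of exp(C‖x‖²) for some C > 0, and c r ≤ C r² + c²/(4C) by
completing the square. -/
theorem integrable_exp_mul_norm_stdGaussian (c : ℝ) :
    Integrable (fun x : E => Real.exp (c * ‖x‖)) (stdGaussian E) := by
  obtain ⟨C, hC, hi⟩ := IsGaussian.exists_integrable_exp_sq (stdGaussian E)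
  refine (hi.const_mul (Real.exp (c ^ 2 / (4 * C)))).mono'
    (by fun_prop) (.of_forall fun x => ?_)
  rw [Real.norm_of_nonneg (Real.exp_pos _).le, ← Real.exp_add]
  refine Real.exp_le_exp.2 ?_
  have h : 0 ≤ C * (‖x‖ - c / (2 * C)) ^ 2 := by positivity
  have h' : C * (‖x‖ - c / (2 * C)) ^ 2 = C * ‖x‖ ^ 2 - c * ‖x‖ + c ^ 2 / (4 * C) := by
    field_simp; ring
  linarith

theorem integrable_exp_mul_norm_add_norm_stdGaussian (c : ℝ) :
    Integrable (fun p : E × E => Real.exp (c * (‖p.1‖ + ‖p.2‖)))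
      ((stdGaussian E).prod (stdGaussian E)) := by
  simp_rw [mul_add, Real.exp_add]
  exact (integrable_exp_mul_norm_stdGaussian c).mul_prod (integrable_exp_mul_norm_stdGaussian c)

theorem measurePreserving_rotation_stdGaussian (θ : ℝ) :
    MeasurePreserving (ContinuousLinearMap.rotation θ : E × E →L[ℝ] E × E)
      ((stdGaussian E).prod (stdGaussian E)) ((stdGaussian E).prod (stdGaussian E)) :=
  ⟨by fun_prop, IsGaussian.map_rotation_eq_self integral_id_stdGaussian θ⟩

theorem integral_inner_mul_inner_stdGaussian (v w : E) :
    ∫ x, ⟪v, x⟫ * ⟪w, x⟫ ∂stdGaussian E = ⟪v, w⟫ := by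
  have h := covarianceBilin_apply (μ := stdGaussian E) IsGaussian.memLp_two_id v w
  rw [covarianceBilin_stdGaussian] at h
  simpa [innerSL_apply_apply ℝ] using h.symm

theorem integrable_norm_stdGaussian : Integrable (fun x : E => ‖x‖) (stdGaussian E) :=
  IsGaussian.integrable_id.norm

end ProbabilityTheory

/-! ### Rotations of pairs, and functions with exponentially weighted increments -/

namespace ProbabilityTheory

section NormedSpace

variable {E : Type*} [NormedAddCommGroup E] [NormedSpace ℝ E]

theorem norm_rotation_sub_fst_le (θ θ' : ℝ) (p : E × E) :
    ‖(ContinuousLinearMap.rotation θ p).1 - (ContinuousLinearMap.rotation θ' p).1‖ ≤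
      |θ - θ'| * (‖p.1‖ + ‖p.2‖) := by
  have h : (ContinuousLinearMap.rotation θ p).1 - (ContinuousLinearMap.rotation θ' p).1 =
      (Real.cos θ - Real.cos θ') • p.1 + (Real.sin θ - Real.sin θ') • p.2 := by
    simp only [ContinuousLinearMap.rotation_apply, sub_smul]; abel
  rw [h]
  refine (norm_add_le _ _).trans ?_
  rw [norm_smul, norm_smul, mul_add]
  gcongr
  · exact Real.abs_cos_sub_cos_le ..
  · exact Real.abs_sin_sub_sin_le ..

theorem norm_rotation_sub_snd_le (θ θ' : ℝ) (p : E × E) :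
    ‖(ContinuousLinearMap.rotation θ p).2 - (ContinuousLinearMap.rotation θ' p).2‖ ≤
      |θ - θ'| * (‖p.1‖ + ‖p.2‖) := by
  have h : (ContinuousLinearMap.rotation θ p).2 - (ContinuousLinearMap.rotation θ' p).2 =
      (Real.sin θ' - Real.sin θ) • p.1 + (Real.cos θ - Real.cos θ') • p.2 := by
    simp only [ContinuousLinearMap.rotation_apply, sub_smul, neg_smul]; abel
  rw [h]
  refine (norm_add_le _ _).trans ?_
  rw [norm_smul, norm_smul, mul_add]
  gcongr
  · rw [abs_sub_comm]; exact Real.abs_sin_sub_sin_le ..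
  · exact Real.abs_cos_sub_cos_le ..

theorem norm_rotation_fst_le (θ : ℝ) (p : E × E) :
    ‖(ContinuousLinearMap.rotation θ p).1‖ ≤ ‖p.1‖ + ‖p.2‖ := by
  simp only [ContinuousLinearMap.rotation_apply]
  refine (norm_add_le _ _).trans ?_
  rw [norm_smul, norm_smul]
  gcongr
  · exact mul_le_of_le_one_left (norm_nonneg _) (Real.abs_cos_le_one θ)
  · exact mul_le_of_le_one_left (norm_nonneg _) (Real.abs_sin_le_one θ)

theorem norm_rotation_snd_le (θ : ℝ) (p : E × E) :
    ‖(ContinuousLinearMap.rotation θ p).2‖ ≤ ‖p.1‖ + ‖p.2‖ := by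
  simp only [ContinuousLinearMap.rotation_apply]
  refine (norm_add_le _ _).trans ?_
  rw [norm_smul, norm_smul, norm_neg]
  gcongr
  · exact mul_le_of_le_one_left (norm_nonneg _) (Real.abs_sin_le_one θ)
  · exact mul_le_of_le_one_left (norm_nonneg _) (Real.abs_cos_le_one θ)

theorem hasDerivAt_rotation_fst (θ : ℝ) (p : E × E) :
    HasDerivAt (fun θ => (ContinuousLinearMap.rotation θ p).1)
      (ContinuousLinearMap.rotation θ p).2 θ := by
  simp only [ContinuousLinearMap.rotation_apply]
  exact ((Real.hasDerivAt_cos θ).smul_const p.1).add ((Real.hasDerivAt_sin θ).smul_const p.2)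

theorem hasDerivAt_rotation_snd (θ : ℝ) (p : E × E) :
    HasDerivAt (fun θ => (ContinuousLinearMap.rotation θ p).2)
      (-(ContinuousLinearMap.rotation θ p).1) θ := by
  simp only [ContinuousLinearMap.rotation_apply]
  refine (((Real.hasDerivAt_sin θ).neg.smul_const p.1).add
    ((Real.hasDerivAt_cos θ).smul_const p.2)).congr_deriv ?_
  simp only [neg_smul, neg_add]

end NormedSpace

section ExpLipschitz

variable {E : Type*} [NormedAddCommGroup E]

/-- A function whose increments are at most linear up to an exponential factor. -/
def ExpLipschitz (C c : ℝ) (φ : E → ℝ) : Prop :=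
  ∀ x y, |φ x - φ y| ≤ C * Real.exp (c * (‖x‖ + ‖y‖)) * ‖x - y‖

namespace ExpLipschitz

variable {φ : E → ℝ} {C c : ℝ}

theorem continuous (hφ : ExpLipschitz C c φ) : Continuous φ := by
  refine continuous_iff_continuousAt.2 fun x => ?_
  rw [ContinuousAt, tendsto_iff_norm_sub_tendsto_zero]
  have h : Filter.Tendsto (fun y => C * Real.exp (c * (‖y‖ + ‖x‖)) * ‖y - x‖) (nhds x)
      (nhds (C * Real.exp (c * (‖x‖ + ‖x‖)) * ‖x - x‖)) :=
    Continuous.tendsto (by fun_prop) x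
  rw [sub_self, norm_zero, mul_zero] at h
  exact squeeze_zero (fun _ => norm_nonneg _) (fun y => hφ y x) h

theorem abs_le (hC : 0 ≤ C) (hφ : ExpLipschitz C c φ) (x : E) :
    |φ x| ≤ (|φ 0| + C) * Real.exp ((|c| + 1) * ‖x‖) := by
  have h := hφ x 0
  rw [norm_zero, add_zero, sub_zero] at h
  have h1 : |φ x| ≤ |φ 0| + |φ x - φ 0| := by
    have := abs_add_le (φ 0) (φ x - φ 0); rwa [add_sub_cancel] at this
  have h2 : ‖x‖ ≤ Real.exp ‖x‖ := by linarith [Real.add_one_le_exp ‖x‖]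
  have h3 : Real.exp (c * ‖x‖) ≤ Real.exp (|c| * ‖x‖) :=
    Real.exp_le_exp.2 (mul_le_mul_of_nonneg_right (le_abs_self c) (norm_nonneg x))
  have h4 : 1 ≤ Real.exp ((|c| + 1) * ‖x‖) := Real.one_le_exp (by positivity)
  rw [add_mul]
  refine h1.trans (add_le_add (le_mul_of_one_le_right (abs_nonneg _) h4) (h.trans ?_))
  rw [add_mul, one_mul, Real.exp_add, mul_assoc]
  gcongr

theorem norm_fderiv_le [NormedSpace ℝ E] (hC : 0 ≤ C) (hc : 0 ≤ c) (hφ : ExpLipschitz C c φ) (x : E) :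
    ‖fderiv ℝ φ x‖ ≤ C * Real.exp (c * (2 * ‖x‖ + 1)) := by
  refine norm_fderiv_le_of_lip' ℝ (by positivity) ?_
  filter_upwards [Metric.ball_mem_nhds x one_pos] with y hy
  refine (hφ y x).trans ?_
  have : ‖y‖ ≤ ‖x‖ + 1 := by
    have h := norm_sub_norm_le y x
    rw [Metric.mem_ball, dist_eq_norm] at hy
    linarith
  gcongr C * Real.exp (c * ?_) * _
  linarith

end ExpLipschitz

end ExpLipschitz

/-! ### Stein's identity -/

variable {E : Type*} [NormedAddCommGroup E] [InnerProductSpace ℝ E] [FiniteDimensional ℝ E] [MeasurableSpace E] [BorelSpace E]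

theorem ExpLipschitz.integrable_stdGaussian {φ : E → ℝ} {C c : ℝ} (hC : 0 ≤ C)
    (hφ : ExpLipschitz C c φ) : Integrable φ (stdGaussian E) :=
  ((integrable_exp_mul_norm_stdGaussian (|c| + 1)).const_mul (|φ 0| + C)).mono'
    (hφ.continuous).aestronglyMeasurable (.of_forall fun x => hφ.abs_le hC x)

theorem ExpLipschitz.integrable_fderiv_mul_norm_sq {φ : E → ℝ} {C c : ℝ} (hC : 0 ≤ C) (hc : 0 ≤ c)
    (hφ : ExpLipschitz C c φ) (v : E) :
    Integrable (fun p : E × E => fderiv ℝ φ p.1 p.2 * ⟪v, p.2⟫)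
      ((stdGaussian E).prod (stdGaussian E)) := by
  have h : Integrable (fun p : E × E => C * Real.exp (c * (2 * ‖p.1‖ + 1)) * (‖v‖ * ‖p.2‖ ^ 2))
      ((stdGaussian E).prod (stdGaussian E)) := by
    refine Integrable.mul_prod (f := fun x : E => C * Real.exp (c * (2 * ‖x‖ + 1)))
      (g := fun y : E => ‖v‖ * ‖y‖ ^ 2) (Integrable.const_mul ?_ _) (Integrable.const_mul ?_ _)
    · have := (integrable_exp_mul_norm_stdGaussian (E := E) (2 * c)).mul_const (Real.exp c)
      refine this.congr (.of_forall fun x => ?_)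
      simp only
      rw [← Real.exp_add]; ring_nf
    · exact (IsGaussian.memLp_two_id (μ := stdGaussian E)).integrable_norm_pow two_ne_zero
  refine h.mono' ?_ (.of_forall fun p => ?_)
  · have h2 : Measurable fun p : E × E => fderiv ℝ φ p.1 p.2 :=
      (isBoundedBilinearMap_apply (𝕜 := ℝ) (E := E) (F := ℝ)).continuous.measurable.comp
        (((measurable_fderiv ℝ φ).comp measurable_fst).prodMk measurable_snd)
    have h3 : Measurable fun p : E × E => ⟪v, p.2⟫ := by fun_prop
    exact (h2.mul h3).aestronglyMeasurable
  · rw [norm_mul]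
    calc ‖fderiv ℝ φ p.1 p.2‖ * ‖⟪v, p.2⟫‖
        ≤ (‖fderiv ℝ φ p.1‖ * ‖p.2‖) * (‖v‖ * ‖p.2‖) :=
          mul_le_mul (ContinuousLinearMap.le_opNorm _ _) (norm_inner_le_norm _ _)
            (norm_nonneg _) (by positivity)
      _ ≤ (C * Real.exp (c * (2 * ‖p.1‖ + 1)) * ‖p.2‖) * (‖v‖ * ‖p.2‖) := by
          gcongr; exact hφ.norm_fderiv_le hC hc _
      _ = _ := by ring

/-- **Stein's identity**: integration by parts for the standard Gaussian measure. -/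
theorem integral_inner_mul_stdGaussian {φ : E → ℝ} {C c : ℝ} (hC : 0 ≤ C) (hc : 0 ≤ c)
    (hφ : ExpLipschitz C c φ) (hd : ∀ᵐ x ∂stdGaussian E, DifferentiableAt ℝ φ x) (v : E) :
    ∫ x, ⟪v, x⟫ * φ x ∂stdGaussian E = ∫ x, fderiv ℝ φ x v ∂stdGaussian E := by
  set γ := stdGaussian E
  set F : ℝ → E × E → ℝ := fun θ p =>
    φ (ContinuousLinearMap.rotation θ p).1 * ⟪v, (ContinuousLinearMap.rotation θ p).2⟫
  have hφc := hφ.continuous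
  have hFc : ∀ θ, Continuous (F θ) := fun θ => by
    have := (ContinuousLinearMap.rotation θ : E × E →L[ℝ] E × E).continuous
    fun_prop
  -- Rotation invariance of the product measure makes this expectation independent of θ; the
  -- identity is the vanishing of its derivative at θ = 0.
  have hconst : ∀ θ, ∫ p, F θ p ∂γ.prod γ = ∫ p, φ p.1 * ⟪v, p.2⟫ ∂γ.prod γ := fun θ => by
    have h := measurePreserving_rotation_stdGaussian (E := E) θ
    have hc : Continuous fun p : E × E => φ p.1 * ⟪v, p.2⟫ := by fun_prop
    exact (integral_map h.measurable.aemeasurable hc.aestronglyMeasurable).symm.trans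
      (by rw [h.map_eq])
  set K : ℝ := (|φ 0| + 2 * C) * ‖v‖
  have hlip : ∀ p : E × E, ∀ θ θ', ‖F θ p - F θ' p‖ ≤
      K * Real.exp ((2 * c + 2) * (‖p.1‖ + ‖p.2‖)) * ‖θ - θ'‖ := fun p θ θ' => by
    set S := ‖p.1‖ + ‖p.2‖
    have hS : 0 ≤ S := by positivity
    set A := (ContinuousLinearMap.rotation θ p).1
    set A' := (ContinuousLinearMap.rotation θ' p).1
    set B := (ContinuousLinearMap.rotation θ p).2
    set B' := (ContinuousLinearMap.rotation θ' p).2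
    have hA : ‖A‖ ≤ S := norm_rotation_fst_le θ p
    have hA' : ‖A'‖ ≤ S := norm_rotation_fst_le θ' p
    have hB : ‖B‖ ≤ S := norm_rotation_snd_le θ p
    have hAA : ‖A - A'‖ ≤ |θ - θ'| * S := norm_rotation_sub_fst_le θ θ' p
    have hBB : ‖B - B'‖ ≤ |θ - θ'| * S := norm_rotation_sub_snd_le θ θ' p
    have e : F θ p - F θ' p = (φ A - φ A') * ⟪v, B⟫ + φ A' * ⟪v, B - B'⟫ := by
      simp only [F, inner_sub_right]; ring
    have h1 : |φ A - φ A'| ≤ C * Real.exp (c * (S + S)) * (|θ - θ'| * S) :=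
      (hφ A A').trans (by gcongr)
    have h2 : |φ A'| ≤ (|φ 0| + C) * Real.exp ((c + 1) * S) := by
      refine (hφ.abs_le hC A').trans ?_
      rw [abs_of_nonneg hc]; gcongr
    have h3 : |⟪v, B⟫| ≤ ‖v‖ * S := (abs_real_inner_le_norm _ _).trans (by gcongr)
    have h4 : |⟪v, B - B'⟫| ≤ ‖v‖ * (|θ - θ'| * S) :=
      (abs_real_inner_le_norm _ _).trans (by gcongr)
    have hS1 : S ≤ Real.exp S := by linarith [Real.add_one_le_exp S]
    have hE1 : Real.exp (c * (S + S)) * (S * S) ≤ Real.exp ((2 * c + 2) * S) := by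
      calc Real.exp (c * (S + S)) * (S * S)
          ≤ Real.exp (c * (S + S)) * (Real.exp S * Real.exp S) := by gcongr
        _ = Real.exp ((2 * c + 2) * S) := by rw [← Real.exp_add, ← Real.exp_add]; ring_nf
    have hE2 : Real.exp ((c + 1) * S) * S ≤ Real.exp ((2 * c + 2) * S) := by
      calc Real.exp ((c + 1) * S) * S ≤ Real.exp ((c + 1) * S) * Real.exp S := by gcongr
        _ = Real.exp ((c + 2) * S) := by rw [← Real.exp_add]; ring_nf
        _ ≤ _ := Real.exp_le_exp.2 (by nlinarith)
    rw [e, Real.norm_eq_abs, Real.norm_eq_abs]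
    calc |(φ A - φ A') * ⟪v, B⟫ + φ A' * ⟪v, B - B'⟫|
        ≤ |φ A - φ A'| * |⟪v, B⟫| + |φ A'| * |⟪v, B - B'⟫| := by
          rw [← abs_mul, ← abs_mul]; exact abs_add_le _ _
      _ ≤ C * Real.exp (c * (S + S)) * (|θ - θ'| * S) * (‖v‖ * S) +
          (|φ 0| + C) * Real.exp ((c + 1) * S) * (‖v‖ * (|θ - θ'| * S)) := by gcongr
      _ = (C * (Real.exp (c * (S + S)) * (S * S)) +
          (|φ 0| + C) * (Real.exp ((c + 1) * S) * S)) * (‖v‖ * |θ - θ'|) := by ring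
      _ ≤ (C * Real.exp ((2 * c + 2) * S) + (|φ 0| + C) * Real.exp ((2 * c + 2) * S)) *
          (‖v‖ * |θ - θ'|) := by gcongr
      _ = _ := by simp only [K]; ring
  have hK : 0 ≤ K := by positivity
  have hv : Integrable (fun y : E => ⟪v, y⟫) γ :=
    IsGaussian.integrable_dual γ (innerSL ℝ v)
  have hF0 : Integrable (F 0) (γ.prod γ) := by
    refine ((hφ.integrable_stdGaussian hC).mul_prod hv).congr (.of_forall fun p => ?_)
    simp [F, ContinuousLinearMap.rotation_apply]
  have hdp : ∀ᵐ p ∂γ.prod γ, DifferentiableAt ℝ φ p.1 :=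
    Measure.quasiMeasurePreserving_fst.ae hd
  have hi1 := hφ.integrable_fderiv_mul_norm_sq hC hc v
  have hvφ : Integrable (fun x => ⟪v, x⟫ * φ x) γ := by
    refine ((integrable_exp_mul_norm_stdGaussian (E := E) (c + 2)).const_mul
      (‖v‖ * (|φ 0| + C))).mono' (by fun_prop) (.of_forall fun x => ?_)
    rw [norm_mul]
    have h1 : ‖⟪v, x⟫‖ ≤ ‖v‖ * Real.exp ‖x‖ := (norm_inner_le_norm _ _).trans (by
      gcongr; linarith [Real.add_one_le_exp ‖x‖])
    have h2 := hφ.abs_le hC x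
    rw [abs_of_nonneg hc] at h2
    calc _ ≤ ‖v‖ * Real.exp ‖x‖ * ((|φ 0| + C) * Real.exp ((c + 1) * ‖x‖)) :=
          mul_le_mul h1 h2 (abs_nonneg _) (by positivity)
      _ = ‖v‖ * (|φ 0| + C) * (Real.exp ‖x‖ * Real.exp ((c + 1) * ‖x‖)) := by ring
      _ = _ := by rw [← Real.exp_add]; ring_nf
  have hi2 : Integrable (fun p : E × E => ⟪v, p.1⟫ * φ p.1) (γ.prod γ) := hvφ.comp_fst γ
  -- The integrand is Lipschitz in θ with an integrable constant, so differentiability of φ is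
  -- required only at almost every first coordinate.
  have key := (hasDerivAt_integral_of_dominated_loc_of_lip (𝕜 := ℝ) (μ := γ.prod γ) (F := F)
    (x₀ := 0)
    (F' := fun p => fderiv ℝ φ p.1 p.2 * ⟪v, p.2⟫ - ⟪v, p.1⟫ * φ p.1)
    (bound := fun p => K * Real.exp ((2 * c + 2) * (‖p.1‖ + ‖p.2‖)))
    Filter.univ_mem (.of_forall fun θ => (hFc θ).aestronglyMeasurable) hF0
    (hi1.sub hi2).aestronglyMeasurable
    (.of_forall fun p => LipschitzOnWith.of_dist_le_mul fun θ _ θ' _ => by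
      rw [dist_eq_norm, dist_eq_norm, Real.coe_nnabs, abs_of_nonneg (by positivity)]
      exact hlip p θ θ')
    ((integrable_exp_mul_norm_add_norm_stdGaussian _).const_mul K)
    (by
      filter_upwards [hdp] with p hp
      have r1 := hasDerivAt_rotation_fst 0 p
      have r2 := hasDerivAt_rotation_snd 0 p
      have e0 : ContinuousLinearMap.rotation 0 p = p := by
        simp [ContinuousLinearMap.rotation_apply]
      have hp' : HasFDerivAt φ (fderiv ℝ φ p.1) (ContinuousLinearMap.rotation 0 p).1 := by
        rw [e0]; exact hp.hasFDerivAt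
      have d1 := hp'.comp_hasDerivAt (0 : ℝ) r1
      have d2 := ((innerSL ℝ v).hasFDerivAt).comp_hasDerivAt (0 : ℝ) r2
      refine (d1.mul d2).congr_deriv ?_
      simp only [Function.comp, e0, innerSL_apply_apply ℝ, inner_neg_right]
      ring)).2
  simp only [hconst] at key
  have h0 := key.unique (hasDerivAt_const _ _)
  rw [integral_sub hi1 hi2, integral_prod _ hi1, sub_eq_zero] at h0
  -- The covariance of the independent copy y is the identity, so averaging over y replaces y by v.
  have e1 : ∀ x, ∫ y, fderiv ℝ φ x y * ⟪v, y⟫ ∂γ = fderiv ℝ φ x v := fun x => by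
    have h := integral_inner_mul_inner_stdGaussian
      ((InnerProductSpace.toDual ℝ E).symm (fderiv ℝ φ x)) v
    simpa using h
  have e2 : ∫ p, ⟪v, p.1⟫ * φ p.1 ∂γ.prod γ = ∫ x, ⟪v, x⟫ * φ x ∂γ := by
    rw [integral_fun_fst (fun x => ⟪v, x⟫ * φ x)]; simp
  rw [← e2, ← h0]
  exact integral_congr_ae (.of_forall fun x => e1 x)

end ProbabilityTheory

/-! ### Gaussian averages of Lipschitz functions -/

namespace ProbabilityTheory

theorem _root_.LipschitzWith.abs_le_add_mul_norm {E : Type*} [NormedAddCommGroup E] {f : E → ℝ} {C : ℝ≥0} (hf : LipschitzWith C f) (x : E) :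
    |f x| ≤ |f 0| + C * ‖x‖ := by
  have h := hf.norm_sub_le x 0
  rw [sub_zero, Real.norm_eq_abs] at h
  have := abs_add_le (f 0) (f x - f 0)
  rw [add_sub_cancel] at this
  linarith

theorem abs_comp_rotation_fst_le {E : Type*} [NormedAddCommGroup E] [NormedSpace ℝ E] {f : E → ℝ}
    {C : ℝ≥0} (hf : LipschitzWith C f) (θ : ℝ) (p : E × E) :
    |f (ContinuousLinearMap.rotation θ p).1| ≤ |f 0| + C * (‖p.1‖ + ‖p.2‖) := by
  refine (hf.abs_le_add_mul_norm _).trans ?_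
  gcongr
  exact norm_rotation_fst_le θ p

variable {E : Type*} [NormedAddCommGroup E] [InnerProductSpace ℝ E] [FiniteDimensional ℝ E]
  [MeasurableSpace E] [BorelSpace E]

/-- A nondegenerate dilation followed by a translation preserves Lebesgue null sets, and Lebesgue
null sets are Gaussian null. -/
theorem ae_stdGaussian_comp_smul_add {c : ℝ} (hc : c ≠ 0) (b : E) {p : E → Prop}
    (h : ∀ᵐ y ∂(volume : Measure E), p y) : ∀ᵐ z ∂stdGaussian E, p (c • z + b) := by
  have h1 : Measure.QuasiMeasurePreserving (fun z : E => c • z) volume volume := by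
    refine ⟨by fun_prop, ?_⟩
    rw [show (fun z : E => c • z) = (c • ·) from rfl, Measure.map_addHaar_smul _ hc]
    exact Measure.smul_absolutelyContinuous
  have h2 := (measurePreserving_add_right (volume : Measure E) b).quasiMeasurePreserving.comp h1
  exact stdGaussian_absolutelyContinuous.ae_le (h2.ae h)

theorem ae_differentiableAt_rotation_fst {f : E → ℝ} {C : ℝ≥0} (hf : LipschitzWith C f) {θ : ℝ}
    (hθ : Real.cos θ ≠ 0) (x : E) :
    ∀ᵐ z ∂stdGaussian E, DifferentiableAt ℝ f (ContinuousLinearMap.rotation θ (z, x)).1 :=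
  ae_stdGaussian_comp_smul_add hθ (Real.sin θ • x) hf.ae_differentiableAt

/-- The average of `f` over the Gaussian law with mean `sin θ • x` and covariance
`cos² θ • id`. -/
noncomputable def gaussAvg (f : E → ℝ) (θ : ℝ) (x : E) : ℝ :=
  ∫ z, f (ContinuousLinearMap.rotation θ (z, x)).1 ∂stdGaussian E

/-- The average of the derivative of `f` over the Gaussian law with mean `sin θ • x` and
covariance `cos² θ • id`. -/
noncomputable def gaussAvgFDeriv (f : E → ℝ) (θ : ℝ) (x : E) : E →L[ℝ] ℝ :=
  ∫ z, fderiv ℝ f (ContinuousLinearMap.rotation θ (z, x)).1 ∂stdGaussian E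

section Lipschitz

variable {f : E → ℝ} {C : ℝ≥0} (hf : LipschitzWith C f)
include hf

theorem integrable_comp_rotation_fst (θ : ℝ) (x : E) :
    Integrable (fun z => f (ContinuousLinearMap.rotation θ (z, x)).1) (stdGaussian E) := by
  have h : Integrable (fun z : E => |f 0| + C * (‖z‖ + ‖x‖)) (stdGaussian E) :=
    (integrable_const _).add ((integrable_norm_stdGaussian.add (integrable_const _)).const_mul _)
  refine h.mono' ?_ (.of_forall fun z => abs_comp_rotation_fst_le hf θ (z, x))
  have := hf.continuous
  simp only [ContinuousLinearMap.rotation_apply]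
  exact Continuous.aestronglyMeasurable (by fun_prop)

theorem abs_gaussAvg_le (θ : ℝ) (x : E) :
    |gaussAvg f θ x| ≤ |f 0| + C * ((∫ z : E, ‖z‖ ∂stdGaussian E) + ‖x‖) := by
  have h : Integrable (fun z : E => |f 0| + C * (‖z‖ + ‖x‖)) (stdGaussian E) :=
    (integrable_const _).add ((integrable_norm_stdGaussian.add (integrable_const _)).const_mul _)
  refine (norm_integral_le_of_norm_le (f := fun z => f (ContinuousLinearMap.rotation θ (z, x)).1) h
    (.of_forall fun z => abs_comp_rotation_fst_le hf θ (z, x))).trans_eq ?_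
  have h' : Integrable (fun z : E => ‖z‖ + ‖x‖) (stdGaussian E) :=
    integrable_norm_stdGaussian.add (integrable_const _)
  rw [integral_add (integrable_const _) (h'.const_mul _), integral_const_mul,
    integral_add integrable_norm_stdGaussian (integrable_const _)]
  simp

theorem abs_gaussAvg_sub_angle_le (θ θ' : ℝ) (x : E) :
    |gaussAvg f θ x - gaussAvg f θ' x| ≤
      C * ((∫ z : E, ‖z‖ ∂stdGaussian E) + ‖x‖) * |θ - θ'| := by
  rw [gaussAvg, gaussAvg, ← integral_sub (integrable_comp_rotation_fst hf θ x)
    (integrable_comp_rotation_fst hf θ' x)]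
  have h : Integrable (fun z : E => C * (|θ - θ'| * (‖z‖ + ‖x‖))) (stdGaussian E) :=
    ((integrable_norm_stdGaussian.add (integrable_const _)).const_mul _).const_mul _
  refine (norm_integral_le_of_norm_le h (.of_forall fun z => (hf.norm_sub_le _ _).trans
    (mul_le_mul_of_nonneg_left (norm_rotation_sub_fst_le θ θ' (z, x)) C.2))).trans_eq ?_
  rw [integral_const_mul, integral_const_mul,
    integral_add integrable_norm_stdGaussian (integrable_const _)]
  simp; ring

theorem abs_gaussAvg_sub_le (θ : ℝ) (x y : E) :
    |gaussAvg f θ x - gaussAvg f θ y| ≤ C * ‖x - y‖ := by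
  rw [gaussAvg, gaussAvg, ← integral_sub (integrable_comp_rotation_fst hf θ x)
    (integrable_comp_rotation_fst hf θ y)]
  refine (norm_integral_le_of_norm_le_const (C := C * ‖x - y‖) (.of_forall fun z =>
    (hf.norm_sub_le _ _).trans ?_)).trans_eq (by simp)
  simp only [ContinuousLinearMap.rotation_apply]
  rw [add_sub_add_left_eq_sub, ← smul_sub, norm_smul]
  gcongr
  exact mul_le_of_le_one_left (norm_nonneg _) (Real.abs_sin_le_one θ)

/-- For cos θ ≠ 0 the law of cos θ z + sin θ x is absolutely continuous, so by Rademacher f is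
differentiable there for almost every z, and the Lipschitz bound dominates the difference quotients.
Averaging thus replaces any smoothness assumption on f. -/
theorem hasDerivAt_gaussAvg_angle {θ : ℝ} (hθ : Real.cos θ ≠ 0) (x : E) :
    HasDerivAt (fun θ => gaussAvg f θ x)
      (∫ z, fderiv ℝ f (ContinuousLinearMap.rotation θ (z, x)).1
        (ContinuousLinearMap.rotation θ (z, x)).2 ∂stdGaussian E) θ := by
  refine (hasDerivAt_integral_of_dominated_loc_of_lip (𝕜 := ℝ)
    (bound := fun z => C * (‖z‖ + ‖x‖)) Filter.univ_mem
    (.of_forall fun θ => (integrable_comp_rotation_fst hf θ x).aestronglyMeasurable)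
    (integrable_comp_rotation_fst hf θ x) ?_ (.of_forall fun z => ?_)
    ((integrable_norm_stdGaussian.add (integrable_const _)).const_mul _) ?_).2
  · have h1 : Continuous fun z : E => ContinuousLinearMap.rotation θ (z, x) := by fun_prop
    exact ((isBoundedBilinearMap_apply (𝕜 := ℝ) (E := E) (F := ℝ)).continuous.measurable.comp
      (((measurable_fderiv ℝ f).comp (continuous_fst.comp h1).measurable).prodMk
        (continuous_snd.comp h1).measurable)).aestronglyMeasurable
  · refine LipschitzOnWith.of_dist_le_mul fun θ _ θ' _ => ?_
    rw [dist_eq_norm, dist_eq_norm, Real.coe_nnabs, abs_of_nonneg (by positivity)]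
    refine (hf.norm_sub_le _ _).trans ?_
    rw [mul_assoc, mul_comm (‖z‖ + ‖x‖)]
    exact mul_le_mul_of_nonneg_left (norm_rotation_sub_fst_le θ θ' (z, x)) C.2
  · filter_upwards [ae_differentiableAt_rotation_fst hf hθ x] with z hz
    exact hz.hasFDerivAt.comp_hasDerivAt θ (hasDerivAt_rotation_fst θ (z, x))

theorem integrable_fderiv_rotation_fst (θ : ℝ) (x : E) :
    Integrable (fun z => fderiv ℝ f (ContinuousLinearMap.rotation θ (z, x)).1)
      (stdGaussian E) := by
  have h1 : Continuous fun z : E => ContinuousLinearMap.rotation θ (z, x) := by fun_prop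
  exact Integrable.of_bound ((measurable_fderiv ℝ f).comp
    (continuous_fst.comp h1).measurable).aestronglyMeasurable C
    (.of_forall fun z => norm_fderiv_le_of_lipschitz ℝ hf)

theorem hasFDerivAt_gaussAvg {θ : ℝ} (hθ : Real.cos θ ≠ 0) (x : E) :
    HasFDerivAt (gaussAvg f θ) (Real.sin θ • gaussAvgFDeriv f θ x) x := by
  rw [gaussAvgFDeriv, ← integral_smul]
  refine (hasFDerivAt_integral_of_dominated_loc_of_lip (𝕜 := ℝ)
    (bound := fun _ => (C : ℝ)) Filter.univ_mem
    (.of_forall fun x => (integrable_comp_rotation_fst hf θ x).aestronglyMeasurable)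
    (integrable_comp_rotation_fst hf θ x)
    ((integrable_fderiv_rotation_fst hf θ x).smul (Real.sin θ)).aestronglyMeasurable
    (.of_forall fun z => ?_) (integrable_const _) ?_).2
  · refine LipschitzOnWith.of_dist_le_mul fun x _ y _ => ?_
    rw [dist_eq_norm, dist_eq_norm, Real.coe_nnabs, abs_of_nonneg C.coe_nonneg]
    refine (hf.norm_sub_le _ _).trans ?_
    simp only [ContinuousLinearMap.rotation_apply]
    rw [add_sub_add_left_eq_sub, ← smul_sub, norm_smul]
    gcongr
    exact mul_le_of_le_one_left (norm_nonneg _) (Real.abs_sin_le_one θ)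
  · filter_upwards [ae_differentiableAt_rotation_fst hf hθ x] with z hz
    have h1 : HasFDerivAt (fun x : E => (ContinuousLinearMap.rotation θ (z, x)).1)
        (Real.sin θ • ContinuousLinearMap.id ℝ E) x := by
      simp only [ContinuousLinearMap.rotation_apply]
      exact ((hasFDerivAt_id x).const_smul (Real.sin θ)).const_add (Real.cos θ • z)
    refine (hz.hasFDerivAt.comp x h1).congr_fderiv ?_
    ext; simp

end Lipschitz

theorem sq_integral_le_integral_sq {α : Type*} [MeasurableSpace α] {μ : Measure α}
    [IsProbabilityMeasure μ] {h : α → ℝ} (h1 : Integrable h μ)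
    (h2 : Integrable (fun x => h x ^ 2) μ) : (∫ x, h x ∂μ) ^ 2 ≤ ∫ x, h x ^ 2 ∂μ :=
  (even_two.convexOn_pow (𝕜 := ℝ)).map_integral_le (continuous_pow 2).continuousOn isClosed_univ
    (.of_forall fun _ => Set.mem_univ _) h1 h2

/-- Jensen's inequality: the average of √g is at most the square root of the average of g, so the
gradient bound survives averaging. -/
theorem norm_gaussAvgFDeriv_le {f g : E → ℝ} {C : ℝ≥0} (hg : LipschitzWith C g)
    (hg0 : ∀ x, 0 ≤ g x) (hfg : ∀ x, ‖fderiv ℝ f x‖ ≤ 2 * √(g x))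
    (θ : ℝ) (x : E) : ‖gaussAvgFDeriv f θ x‖ ≤ 2 * √(gaussAvg g θ x) := by
  have hgi := integrable_comp_rotation_fst hg θ x
  have hs : Integrable (fun z => √(g (ContinuousLinearMap.rotation θ (z, x)).1))
      (stdGaussian E) := by
    refine ((integrable_const 1).add hgi).mono' (hgi.aemeasurable.sqrt.aestronglyMeasurable)
      (.of_forall fun z => ?_)
    rw [Real.norm_of_nonneg (Real.sqrt_nonneg _)]
    refine Real.sqrt_le_iff.2 ⟨?_, ?_⟩ <;>
    simp only [Pi.add_apply] <;>
    nlinarith [hg0 (ContinuousLinearMap.rotation θ (z, x)).1]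
  refine (norm_integral_le_of_norm_le (hs.const_mul 2) (.of_forall fun z => hfg _)).trans ?_
  rw [integral_const_mul]
  gcongr
  refine Real.le_sqrt_of_sq_le ?_
  refine (sq_integral_le_integral_sq hs ?_).trans_eq ?_
  · simpa only [Real.sq_sqrt (hg0 _)] using hgi
  · simp only [Real.sq_sqrt (hg0 _), gaussAvg]

end ProbabilityTheory

/-! ### Integration by parts along the rotation -/

namespace ProbabilityTheory

theorem rotation_neg_rotation {E : Type*} [NormedAddCommGroup E] [NormedSpace ℝ E] (θ : ℝ) (p : E × E) :
    ContinuousLinearMap.rotation (-θ) (ContinuousLinearMap.rotation θ p) = p := by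
  have h := Real.cos_sq_add_sin_sq θ
  ext
  · simp only [ContinuousLinearMap.rotation_apply, Real.cos_neg, Real.sin_neg]
    match_scalars <;> first | ring1 | linear_combination h
  · simp only [ContinuousLinearMap.rotation_apply, Real.cos_neg, Real.sin_neg]
    match_scalars <;> first | ring1 | linear_combination h

variable {E : Type*} [NormedAddCommGroup E] [InnerProductSpace ℝ E] [FiniteDimensional ℝ E]
  [MeasurableSpace E] [BorelSpace E]

theorem integral_comp_rotation {F : E × E → ℝ}
    (hF : AEStronglyMeasurable F ((stdGaussian E).prod (stdGaussian E))) (θ : ℝ) :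
    ∫ p, F (ContinuousLinearMap.rotation θ p) ∂(stdGaussian E).prod (stdGaussian E) =
      ∫ p, F p ∂(stdGaussian E).prod (stdGaussian E) := by
  have h := measurePreserving_rotation_stdGaussian (E := E) θ
  refine (integral_map h.measurable.aemeasurable (by rwa [h.map_eq])).symm.trans ?_
  rw [h.map_eq]

/-- Integration by parts in the direction of rotation. -/
theorem integral_mul_fderiv_rotation {f φ : E → ℝ} {C : ℝ≥0} {K c : ℝ} (hf : LipschitzWith C f)
    (hK : 0 ≤ K) (hc : 0 ≤ c) (hφ : ExpLipschitz K c φ) (hφd : Differentiable ℝ φ) (θ : ℝ) :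
    Integrable (fun p : E × E => φ p.2 * fderiv ℝ f (ContinuousLinearMap.rotation θ p).1
        (ContinuousLinearMap.rotation θ p).2) ((stdGaussian E).prod (stdGaussian E)) ∧
    Integrable (fun p : E × E => fderiv ℝ φ p.2 ((InnerProductSpace.toDual ℝ E).symm
        (fderiv ℝ f (ContinuousLinearMap.rotation θ p).1)))
        ((stdGaussian E).prod (stdGaussian E)) ∧
    ∫ p, φ p.2 * fderiv ℝ f (ContinuousLinearMap.rotation θ p).1
        (ContinuousLinearMap.rotation θ p).2 ∂(stdGaussian E).prod (stdGaussian E) =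
      Real.cos θ * ∫ p, fderiv ℝ φ p.2 ((InnerProductSpace.toDual ℝ E).symm
        (fderiv ℝ f (ContinuousLinearMap.rotation θ p).1))
          ∂(stdGaussian E).prod (stdGaussian E) := by
  set γ := stdGaussian E with hγ
  set e : (E →L[ℝ] ℝ) → E := fun L => (InnerProductSpace.toDual ℝ E).symm L with he
  have hec : Continuous e := LinearIsometryEquiv.continuous _
  have hr : ∀ θ, Continuous (ContinuousLinearMap.rotation θ : E × E → E × E) := fun θ =>
    ContinuousLinearMap.continuous _
  have happ : Continuous fun q : (E →L[ℝ] ℝ) × E => q.1 q.2 :=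
    isBoundedBilinearMap_apply.continuous
  have hmf : Measurable (fderiv ℝ f) := measurable_fderiv ℝ f
  have hmφ : Measurable (fderiv ℝ φ) := measurable_fderiv ℝ φ
  have hφm : Measurable φ := hφ.continuous.measurable
  have hfn : ∀ x, ‖fderiv ℝ f x‖ ≤ C := fun x => norm_fderiv_le_of_lipschitz ℝ hf
  set F1 : E × E → ℝ := fun p => φ p.2 * fderiv ℝ f (ContinuousLinearMap.rotation θ p).1
        (ContinuousLinearMap.rotation θ p).2
  set F2 : E × E → ℝ := fun p => fderiv ℝ φ p.2 (e
        (fderiv ℝ f (ContinuousLinearMap.rotation θ p).1))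
  have hF1 : Measurable F1 := (hφm.comp measurable_snd).mul <| happ.measurable.comp <|
    (hmf.comp (measurable_fst.comp (hr θ).measurable)).prodMk
      (measurable_snd.comp (hr θ).measurable)
  have hF2 : Measurable F2 := happ.measurable.comp <| (hmφ.comp measurable_snd).prodMk <|
    hec.measurable.comp (hmf.comp (measurable_fst.comp (hr θ).measurable))
  have hi1 : Integrable F1 (γ.prod γ) := by
    refine ((integrable_exp_mul_norm_add_norm_stdGaussian (c + 2)).const_mul
      ((|φ 0| + K) * C)).mono' hF1.aestronglyMeasurable (.of_forall fun p => ?_)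
    set S := ‖p.1‖ + ‖p.2‖
    have h1 : |φ p.2| ≤ (|φ 0| + K) * Real.exp ((c + 1) * S) := by
      refine (hφ.abs_le hK _).trans ?_
      rw [abs_of_nonneg hc]
      gcongr
      exact le_add_of_nonneg_left (norm_nonneg _)
    have h2 : ‖fderiv ℝ f (ContinuousLinearMap.rotation θ p).1
        (ContinuousLinearMap.rotation θ p).2‖ ≤ C * Real.exp S :=
      (ContinuousLinearMap.le_opNorm _ _).trans (mul_le_mul (hfn _)
        ((norm_rotation_snd_le θ p).trans (by linarith [Real.add_one_le_exp S]))
        (norm_nonneg _) C.coe_nonneg)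
    rw [norm_mul]
    calc _ ≤ (|φ 0| + K) * Real.exp ((c + 1) * S) * (C * Real.exp S) :=
          mul_le_mul h1 h2 (norm_nonneg _) (by positivity)
      _ = (|φ 0| + K) * C * (Real.exp ((c + 1) * S) * Real.exp S) := by ring
      _ = _ := by rw [← Real.exp_add]; ring_nf
  have hi2 : Integrable F2 (γ.prod γ) := by
    have hb : Integrable (fun p : E × E => K * Real.exp (c * (2 * ‖p.2‖ + 1)) * C)
        (γ.prod γ) := by
      have h := (((integrable_exp_mul_norm_stdGaussian (E := E) (2 * c)).comp_snd γ).const_mul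
        (K * C * Real.exp c))
      refine h.congr (.of_forall fun p => ?_)
      simp only
      rw [mul_assoc (K * C), ← Real.exp_add]; ring_nf
    refine hb.mono' hF2.aestronglyMeasurable (.of_forall fun p => ?_)
    refine (ContinuousLinearMap.le_opNorm _ _).trans (mul_le_mul (hφ.norm_fderiv_le hK hc _) ?_
      (norm_nonneg _) (by positivity))
    rw [he, LinearIsometryEquiv.norm_map]; exact hfn _
  refine ⟨hi1, hi2, ?_⟩
  have hinv : ∀ p : E × E, ContinuousLinearMap.rotation θ (ContinuousLinearMap.rotation (-θ) p)
      = p := fun p => by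
    have := rotation_neg_rotation (-θ) p; rwa [neg_neg] at this
  -- Change variables so that the rotated pair becomes the independent pair (y, w). The derivative
  -- of f is then frozen at y, and φ is evaluated at sin θ y + cos θ w. Stein's identity in w alone
  -- yields the factor cos θ and never differentiates f twice.
  rw [← integral_comp_rotation hF1.aestronglyMeasurable (-θ),
    ← integral_comp_rotation hF2.aestronglyMeasurable (-θ)]
  have hi1' := (measurePreserving_rotation_stdGaussian (E := E) (-θ)).integrable_comp_of_integrable
    hi1
  have hi2' := (measurePreserving_rotation_stdGaussian (E := E) (-θ)).integrable_comp_of_integrable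
    hi2
  have hi1'' := integral_prod _ hi1'
  have hi2'' := integral_prod _ hi2'
  simp only [Function.comp] at hi1'' hi2''
  rw [hi1'', hi2'', ← integral_const_mul]
  refine integral_congr_ae (.of_forall fun y => ?_)
  simp only
  rw [← integral_const_mul]
  set ψ : E → ℝ := fun w => φ (ContinuousLinearMap.rotation (-θ) (y, w)).2
  have hψ : ExpLipschitz (K * Real.exp (c * (2 * ‖y‖))) c ψ := fun w w' => by
    refine (hφ _ _).trans ?_
    have h1 := norm_rotation_snd_le (-θ) (y, w)
    have h2 := norm_rotation_snd_le (-θ) (y, w')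
    have h3 : ‖(ContinuousLinearMap.rotation (-θ) (y, w)).2 -
        (ContinuousLinearMap.rotation (-θ) (y, w')).2‖ ≤ ‖w - w'‖ := by
      simp only [ContinuousLinearMap.rotation_apply]
      rw [add_sub_add_left_eq_sub, ← smul_sub, norm_smul]
      exact mul_le_of_le_one_left (norm_nonneg _) (Real.abs_cos_le_one _)
    rw [mul_assoc K (Real.exp (c * (2 * ‖y‖))), ← Real.exp_add]
    gcongr
    calc _ ≤ c * ((‖y‖ + ‖w‖) + (‖y‖ + ‖w'‖)) := by gcongr
      _ = _ := by ring
  have hψd : ∀ w, HasFDerivAt ψ (Real.cos θ • fderiv ℝ φ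
      (ContinuousLinearMap.rotation (-θ) (y, w)).2) w := fun w => by
    have h1 : HasFDerivAt (fun w : E => (ContinuousLinearMap.rotation (-θ) (y, w)).2)
        (Real.cos θ • ContinuousLinearMap.id ℝ E) w := by
      simp only [ContinuousLinearMap.rotation_apply, Real.cos_neg]
      exact ((hasFDerivAt_id w).const_smul (Real.cos θ)).const_add _
    refine ((hφd _).hasFDerivAt.comp w h1).congr_fderiv ?_
    ext; simp
  have hst := integral_inner_mul_stdGaussian (by positivity) hc hψ
    (.of_forall fun w => (hψd w).differentiableAt) (e (fderiv ℝ f y))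
  simp only [F1, F2, hinv]
  calc ∫ w, φ (ContinuousLinearMap.rotation (-θ) (y, w)).2 * fderiv ℝ f y w ∂γ
      = ∫ w, ⟪e (fderiv ℝ f y), w⟫ * ψ w ∂γ := by
        refine integral_congr_ae (.of_forall fun w => ?_)
        simp only [he, InnerProductSpace.toDual_symm_apply, ψ]
        rw [mul_comm]
    _ = _ := hst
    _ = _ := by
        refine integral_congr_ae (.of_forall fun w => ?_)
        simp only
        rw [(hψd w).fderiv]; simp

end ProbabilityTheory

/-! ### The interpolating exponent and its growth bounds -/

namespace ProbabilityTheory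

/-- The weight of the squared gradient in the interpolation: the solution of
`a' = -4 sin θ cos θ (l + a)²` which vanishes at `θ = π / 2`. -/
noncomputable def interpCoef (l θ : ℝ) : ℝ := l / (1 - 2 * l * Real.cos θ ^ 2) - l

section interpCoef

variable {l : ℝ} (hl0 : 0 ≤ l) (hl : l < 1 / 2) (θ : ℝ)
include hl0

theorem one_sub_le_one_sub_two_mul_cos_sq : 1 - 2 * l ≤ 1 - 2 * l * Real.cos θ ^ 2 := by
  nlinarith [Real.cos_sq_le_one θ]

include hl

theorem add_interpCoef_le : l + interpCoef l θ ≤ l / (1 - 2 * l) := by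
  have h := one_sub_le_one_sub_two_mul_cos_sq hl0 θ
  have : 0 < 1 - 2 * l := by linarith
  rw [interpCoef, add_sub_cancel]
  gcongr

theorem interpCoef_nonneg : 0 ≤ interpCoef l θ := by
  have h := one_sub_le_one_sub_two_mul_cos_sq hl0 θ
  have h1 : 0 < 1 - 2 * l * Real.cos θ ^ 2 := by linarith
  rw [interpCoef, sub_nonneg, le_div_iff₀ h1]
  nlinarith [mul_nonneg (mul_self_nonneg l) (sq_nonneg (Real.cos θ))]

theorem hasDerivAt_interpCoef : HasDerivAt (interpCoef l)
    (-(4 * (Real.sin θ * Real.cos θ) * (l + interpCoef l θ) ^ 2)) θ := by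
  have h := one_sub_le_one_sub_two_mul_cos_sq hl0 θ
  have h1 : 1 - 2 * l * Real.cos θ ^ 2 ≠ 0 := by linarith
  have h2 := ((((Real.hasDerivAt_cos θ).pow 2).const_mul (2 * l)).const_sub 1)
  refine (((hasDerivAt_const θ l).div h2 h1).sub_const l).congr_deriv ?_
  rw [interpCoef]
  simp only [Pi.pow_apply]
  field_simp
  ring

theorem abs_interpCoef_sub_le (θ' : ℝ) :
    |interpCoef l θ - interpCoef l θ'| ≤ 4 * (l / (1 - 2 * l)) ^ 2 * |θ - θ'| := by
  refine Convex.norm_image_sub_le_of_norm_hasDerivWithin_le (𝕜 := ℝ) (s := Set.univ)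
    (fun x _ => (hasDerivAt_interpCoef hl0 hl x).hasDerivWithinAt) (fun x _ => ?_) convex_univ
    (Set.mem_univ θ') (Set.mem_univ θ)
  rw [norm_neg, norm_mul, norm_mul, norm_mul, Real.norm_of_nonneg (sq_nonneg _)]
  have h1 := add_interpCoef_le hl0 hl x
  have h2 := interpCoef_nonneg hl0 hl x
  have h3 : ‖Real.sin x‖ * ‖Real.cos x‖ ≤ 1 :=
    mul_le_one₀ (Real.abs_sin_le_one x) (abs_nonneg _) (Real.abs_cos_le_one x)
  have h4 : (l + interpCoef l x) ^ 2 ≤ (l / (1 - 2 * l)) ^ 2 := by gcongr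
  calc _ ≤ ‖(4 : ℝ)‖ * 1 * (l / (1 - 2 * l)) ^ 2 := by gcongr
    _ = _ := by norm_num

end interpCoef

variable {E : Type*} [NormedAddCommGroup E] [InnerProductSpace ℝ E] [FiniteDimensional ℝ E]
  [MeasurableSpace E] [BorelSpace E]

/-- The exponent interpolating between `l * f` at `θ = π / 2` and a constant at `θ = 0`. -/
noncomputable def interpExponent (l : ℝ) (f g : E → ℝ) (θ : ℝ) (x : E) : ℝ :=
  l * gaussAvg f θ x + interpCoef l θ * gaussAvg g θ x

theorem exists_bounds_gaussAvg {f : E → ℝ} {C : ℝ≥0} (hf : LipschitzWith C f) :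
    ∃ K, 0 ≤ K ∧ (∀ θ x, |gaussAvg f θ x| ≤ K * (1 + ‖x‖)) ∧
      (∀ θ θ' x, |gaussAvg f θ x - gaussAvg f θ' x| ≤ K * (1 + ‖x‖) * |θ - θ'|) ∧
      ∀ θ x y, |gaussAvg f θ x - gaussAvg f θ y| ≤ K * ‖x - y‖ := by
  set m := ∫ z : E, ‖z‖ ∂stdGaussian E
  have hm : 0 ≤ m := integral_nonneg fun _ => norm_nonneg _
  have hC := C.coe_nonneg
  have h0 := abs_nonneg (f 0)
  have h1 : ∀ x : E, C * (m + ‖x‖) ≤ (|f 0| + C * (m + 1)) * (1 + ‖x‖) := fun x => by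
    have := norm_nonneg x
    nlinarith [mul_nonneg hC hm, mul_nonneg hC this, mul_nonneg h0 this,
      mul_nonneg (mul_nonneg hC hm) this]
  refine ⟨|f 0| + C * (m + 1), by positivity, fun θ x => ?_, fun θ θ' x => ?_, fun θ x y => ?_⟩
  · refine (abs_gaussAvg_le hf θ x).trans ?_
    have := norm_nonneg x
    nlinarith [mul_nonneg hC hm, mul_nonneg hC this, mul_nonneg h0 this,
      mul_nonneg (mul_nonneg hC hm) this]
  · refine (abs_gaussAvg_sub_angle_le hf θ θ' x).trans ?_
    exact mul_le_mul_of_nonneg_right (h1 x) (abs_nonneg _)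
  · refine (abs_gaussAvg_sub_le hf θ x y).trans ?_
    gcongr
    nlinarith [mul_nonneg hC hm]

theorem abs_mul_le_of_le {a b A B : ℝ} (ha : |a| ≤ A) (hb : |b| ≤ B) : |a * b| ≤ A * B := by
  rw [abs_mul]
  exact mul_le_mul ha hb (abs_nonneg _) ((abs_nonneg _).trans ha)

/-- A single constant, uniform in θ, serves both for differentiating the expectation in θ under the
integral and for integrating by parts against the exponential. -/
theorem exists_bounds_interpExponent {l : ℝ} (hl0 : 0 ≤ l) (hl : l < 1 / 2) {f g : E → ℝ}
    {C : ℝ≥0} (hf : LipschitzWith C f) (hg : LipschitzWith C g) :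
    ∃ K, 0 ≤ K ∧ (∀ θ x, |interpExponent l f g θ x| ≤ K * (1 + ‖x‖)) ∧
      (∀ θ θ' x, |interpExponent l f g θ x - interpExponent l f g θ' x| ≤
        K * (1 + ‖x‖) * |θ - θ'|) ∧
      ∀ θ x y, |interpExponent l f g θ x - interpExponent l f g θ y| ≤ K * ‖x - y‖ := by
  obtain ⟨k, hk, f1, f2, f3⟩ := exists_bounds_gaussAvg hf
  obtain ⟨k', hk', g1, g2, g3⟩ := exists_bounds_gaussAvg hg
  set B := l / (1 - 2 * l)
  have hB : 0 ≤ B := div_nonneg hl0 (by linarith)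
  have hc : ∀ θ, |interpCoef l θ| ≤ B := fun θ => by
    rw [abs_of_nonneg (interpCoef_nonneg hl0 hl θ)]
    linarith [add_interpCoef_le hl0 hl θ]
  have hc' := abs_interpCoef_sub_le hl0 hl
  have hll : |l| ≤ l := (abs_of_nonneg hl0).le
  refine ⟨l * k + B * k' + 4 * B ^ 2 * k', by positivity, fun θ x => ?_, fun θ θ' x => ?_,
    fun θ x y => ?_⟩
  · refine (abs_add_le _ _).trans ((add_le_add (abs_mul_le_of_le hll (f1 θ x))
      (abs_mul_le_of_le (hc θ) (g1 θ x))).trans ?_)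
    have : 0 ≤ 4 * B ^ 2 * k' * (1 + ‖x‖) := by positivity
    linarith
  · have e : interpExponent l f g θ x - interpExponent l f g θ' x =
        l * (gaussAvg f θ x - gaussAvg f θ' x) +
        (interpCoef l θ * (gaussAvg g θ x - gaussAvg g θ' x) +
        (interpCoef l θ - interpCoef l θ') * gaussAvg g θ' x) := by
      simp only [interpExponent]; ring
    rw [e]
    refine (abs_add_le _ _).trans ((add_le_add (abs_mul_le_of_le hll (f2 θ θ' x))
      ((abs_add_le _ _).trans (add_le_add (abs_mul_le_of_le (hc θ) (g2 θ θ' x))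
        (abs_mul_le_of_le (hc' θ θ') (g1 θ' x))))).trans_eq ?_)
    ring
  · have e : interpExponent l f g θ x - interpExponent l f g θ y =
        l * (gaussAvg f θ x - gaussAvg f θ y) +
        interpCoef l θ * (gaussAvg g θ x - gaussAvg g θ y) := by
      simp only [interpExponent]; ring
    rw [e]
    refine (abs_add_le _ _).trans ((add_le_add (abs_mul_le_of_le hll (f3 θ x y))
      (abs_mul_le_of_le (hc θ) (g3 θ x y))).trans ?_)
    have : 0 ≤ 4 * B ^ 2 * k' * ‖x - y‖ := by positivity
    linarith

theorem abs_exp_sub_exp_le {a b M : ℝ} (ha : a ≤ M) (hb : b ≤ M) :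
    |Real.exp a - Real.exp b| ≤ Real.exp M * |a - b| := by
  wlog h : b ≤ a generalizing a b
  · rw [abs_sub_comm, abs_sub_comm a]; exact this hb ha (le_of_not_ge h)
  rw [abs_of_nonneg (sub_nonneg.2 (Real.exp_le_exp.2 h)), abs_of_nonneg (sub_nonneg.2 h)]
  have h1 : Real.exp a - Real.exp b = Real.exp a * (1 - Real.exp (b - a)) := by
    rw [mul_sub, mul_one, ← Real.exp_add, add_sub_cancel]
  rw [h1]
  have h2 := Real.add_one_le_exp (b - a)
  have h3 : Real.exp a ≤ Real.exp M := Real.exp_le_exp.2 ha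
  exact mul_le_mul h3 (by linarith) (by linarith [Real.exp_le_one_iff.2 (sub_nonpos.2 h)])
    (Real.exp_pos _).le

theorem expLipschitz_exp {E : Type*} [NormedAddCommGroup E] {u : E → ℝ} {K : ℝ} (hK : 0 ≤ K) (h1 : ∀ x, |u x| ≤ K * (1 + ‖x‖))
    (h2 : ∀ x y, |u x - u y| ≤ K * ‖x - y‖) :
    ExpLipschitz (Real.exp K * K) K (fun x => Real.exp (u x)) := fun x y => by
  have hx := (le_abs_self _).trans (h1 x)
  have hy := (le_abs_self _).trans (h1 y)
  have := norm_nonneg x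
  have := norm_nonneg y
  refine (abs_exp_sub_exp_le (M := K + K * (‖x‖ + ‖y‖)) (by nlinarith) (by nlinarith)).trans ?_
  rw [Real.exp_add]
  calc _ ≤ Real.exp K * Real.exp (K * (‖x‖ + ‖y‖)) * (K * ‖x - y‖) := by gcongr; exact h2 x y
    _ = _ := by ring

theorem integrable_exp_linear_mul_stdGaussian {K : ℝ} (hK : 0 ≤ K) :
    Integrable (fun x : E => Real.exp (K * (1 + ‖x‖)) * (K * (1 + ‖x‖))) (stdGaussian E) := by
  refine ((integrable_exp_mul_norm_stdGaussian (E := E) (K + 1)).const_mul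
    (Real.exp K * (K * Real.exp 1))).mono' (by fun_prop) (.of_forall fun x => ?_)
  rw [Real.norm_of_nonneg (by positivity)]
  have h : 1 + ‖x‖ ≤ Real.exp 1 * Real.exp ‖x‖ := by
    rw [← Real.exp_add]; linarith [Real.add_one_le_exp (1 + ‖x‖)]
  calc _ ≤ Real.exp (K * (1 + ‖x‖)) * (K * (Real.exp 1 * Real.exp ‖x‖)) := by gcongr
    _ = K * (Real.exp (K * (1 + ‖x‖)) * (Real.exp 1 * Real.exp ‖x‖)) := by ring
    _ = K * (Real.exp K * Real.exp 1 * Real.exp ((K + 1) * ‖x‖)) := by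
        rw [← Real.exp_add, ← Real.exp_add, ← Real.exp_add, ← Real.exp_add]; ring_nf
    _ = _ := by ring

end ProbabilityTheory

/-! ### Monotonicity of the interpolation and the exponential moment bound -/

namespace ProbabilityTheory

variable {E : Type*} [NormedAddCommGroup E] [InnerProductSpace ℝ E] [FiniteDimensional ℝ E]
  [MeasurableSpace E] [BorelSpace E]

/-- The derivative of `gaussAvg f θ x` in `θ`. -/
noncomputable def gaussAvgAngleDeriv (f : E → ℝ) (θ : ℝ) (x : E) : ℝ :=
  ∫ z, fderiv ℝ f (ContinuousLinearMap.rotation θ (z, x)).1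
    (ContinuousLinearMap.rotation θ (z, x)).2 ∂stdGaussian E

theorem measurable_gaussAvgAngleDeriv (f : E → ℝ) (θ : ℝ) :
    Measurable (gaussAvgAngleDeriv f θ) := by
  have h1 : Continuous (ContinuousLinearMap.rotation θ : E × E → E × E) :=
    ContinuousLinearMap.continuous _
  have h2 : Measurable fun p : E × E => fderiv ℝ f (ContinuousLinearMap.rotation θ p).1
      (ContinuousLinearMap.rotation θ p).2 :=
    (isBoundedBilinearMap_apply (𝕜 := ℝ) (E := E) (F := ℝ)).continuous.measurable.comp
      (((measurable_fderiv ℝ f).comp (continuous_fst.comp h1).measurable).prodMk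
        (continuous_snd.comp h1).measurable)
  exact h2.stronglyMeasurable.integral_prod_left'.measurable

/-- The rotational integration by parts after integrating out z: what remains on the left is the
θ-derivative of the average, and on the right the averaged gradient. -/
theorem integral_mul_gaussAvgAngleDeriv {f φ : E → ℝ} {C : ℝ≥0} {K c : ℝ}
    (hf : LipschitzWith C f) (hK : 0 ≤ K) (hc : 0 ≤ c) (hφ : ExpLipschitz K c φ)
    (hφd : Differentiable ℝ φ) (θ : ℝ) :
    Integrable (fun x => φ x * gaussAvgAngleDeriv f θ x) (stdGaussian E) ∧
    Integrable (fun x => fderiv ℝ φ x ((InnerProductSpace.toDual ℝ E).symm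
      (gaussAvgFDeriv f θ x))) (stdGaussian E) ∧
    ∫ x, φ x * gaussAvgAngleDeriv f θ x ∂stdGaussian E =
      Real.cos θ * ∫ x, fderiv ℝ φ x ((InnerProductSpace.toDual ℝ E).symm
        (gaussAvgFDeriv f θ x)) ∂stdGaussian E := by
  obtain ⟨h1, h2, h3⟩ := integral_mul_fderiv_rotation hf hK hc hφ hφd θ
  rw [integral_prod_symm _ h1, integral_prod_symm _ h2] at h3
  have e1 : ∀ x, ∫ z, φ x * fderiv ℝ f (ContinuousLinearMap.rotation θ (z, x)).1
      (ContinuousLinearMap.rotation θ (z, x)).2 ∂stdGaussian E =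
      φ x * gaussAvgAngleDeriv f θ x := fun x => integral_const_mul _ _
  have e2 : ∀ x, ∫ z, fderiv ℝ φ x ((InnerProductSpace.toDual ℝ E).symm
      (fderiv ℝ f (ContinuousLinearMap.rotation θ (z, x)).1)) ∂stdGaussian E =
      fderiv ℝ φ x ((InnerProductSpace.toDual ℝ E).symm (gaussAvgFDeriv f θ x)) := fun x => by
    have hi := integrable_fderiv_rotation_fst hf θ x
    set T : (E →L[ℝ] ℝ) →L[ℝ] E :=
      { toFun := fun L => (InnerProductSpace.toDual ℝ E).symm L
        map_add' := fun _ _ => map_add _ _ _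
        map_smul' := fun c L => by simp
        cont := LinearIsometryEquiv.continuous _ }
    exact ((fderiv ℝ φ x).comp T).integral_comp_comm hi
  simp only [e1, e2] at h3
  refine ⟨?_, ?_, h3⟩
  · simpa only [e1] using h1.integral_prod_right
  · simpa only [e2] using h2.integral_prod_right

section

variable {l : ℝ} (hl0 : 0 ≤ l) (hl : l < 1 / 2) {f g : E → ℝ} {C : ℝ≥0}
  (hf : LipschitzWith C f) (hg : LipschitzWith C g)
include hl0 hl hf hg

theorem continuous_interpExponent (θ : ℝ) : Continuous (interpExponent l f g θ) := by
  obtain ⟨K, hK, -, -, h⟩ := exists_bounds_interpExponent hl0 hl hf hg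
  exact (LipschitzWith.of_dist_le_mul (K := ⟨K, hK⟩) fun x y => by
    rw [dist_eq_norm, dist_eq_norm]; exact h θ x y).continuous

theorem continuous_integral_exp_interpExponent :
    Continuous fun θ => ∫ x, Real.exp (interpExponent l f g θ x) ∂stdGaussian E := by
  obtain ⟨K, hK, h1, h2, -⟩ := exists_bounds_interpExponent hl0 hl hf hg
  refine continuous_of_dominated (bound := fun x => Real.exp (K * (1 + ‖x‖)))
    (fun θ => (Real.continuous_exp.comp
      (continuous_interpExponent hl0 hl hf hg θ)).aestronglyMeasurable)
    (fun θ => .of_forall fun x => ?_) ?_ (.of_forall fun x => ?_)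
  · rw [Real.norm_of_nonneg (Real.exp_pos _).le]
    exact Real.exp_le_exp.2 ((le_abs_self _).trans (h1 θ x))
  · simp_rw [mul_add, Real.exp_add]
    exact (integrable_exp_mul_norm_stdGaussian K).const_mul _
  · have hx : 0 ≤ K * (1 + ‖x‖) := by positivity
    exact Real.continuous_exp.comp
      (LipschitzWith.of_dist_le_mul (K := ⟨_, hx⟩) fun θ θ' => h2 θ θ' x).continuous

theorem hasDerivAt_integral_exp_interpExponent {θ : ℝ} (hθ : Real.cos θ ≠ 0) :
    Integrable (fun x => Real.exp (interpExponent l f g θ x) * (l * gaussAvgAngleDeriv f θ x +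
      (interpCoef l θ * gaussAvgAngleDeriv g θ x -
        4 * (Real.sin θ * Real.cos θ) * (l + interpCoef l θ) ^ 2 * gaussAvg g θ x)))
      (stdGaussian E) ∧
    HasDerivAt (fun θ => ∫ x, Real.exp (interpExponent l f g θ x) ∂stdGaussian E)
      (∫ x, Real.exp (interpExponent l f g θ x) * (l * gaussAvgAngleDeriv f θ x +
      (interpCoef l θ * gaussAvgAngleDeriv g θ x -
        4 * (Real.sin θ * Real.cos θ) * (l + interpCoef l θ) ^ 2 * gaussAvg g θ x))
        ∂stdGaussian E) θ := by
  obtain ⟨K, hK, h1, h2, h3⟩ := exists_bounds_interpExponent hl0 hl hf hg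
  have hm : ∀ θ, AEStronglyMeasurable (fun x => Real.exp (interpExponent l f g θ x))
      (stdGaussian E) := fun θ => (Real.continuous_exp.comp
      (continuous_interpExponent hl0 hl hf hg θ)).aestronglyMeasurable
  refine hasDerivAt_integral_of_dominated_loc_of_lip (𝕜 := ℝ)
    (bound := fun x => Real.exp (K * (1 + ‖x‖)) * (K * (1 + ‖x‖))) Filter.univ_mem
    (.of_forall hm) ?_ ?_ (.of_forall fun x => LipschitzOnWith.of_dist_le_mul fun θ _ θ' _ => ?_)
    (integrable_exp_linear_mul_stdGaussian hK) (.of_forall fun x => ?_)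
  · exact (expLipschitz_exp hK (h1 θ) (h3 θ)).integrable_stdGaussian (by positivity)
  · have hgc : Continuous (gaussAvg g θ) :=
      (LipschitzWith.of_dist_le_mul (K := C) fun x y => by
        rw [dist_eq_norm, dist_eq_norm]; exact abs_gaussAvg_sub_le hg θ x y).continuous
    exact (hm θ).mul (((measurable_gaussAvgAngleDeriv f θ).const_mul l).add
      (((measurable_gaussAvgAngleDeriv g θ).const_mul _).sub
        (hgc.measurable.const_mul _))).aestronglyMeasurable
  · rw [Real.coe_nnabs, abs_of_nonneg (by positivity), mul_assoc]
    refine (abs_exp_sub_exp_le ((le_abs_self _).trans (h1 θ x))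
      ((le_abs_self _).trans (h1 θ' x))).trans ?_
    gcongr
    exact h2 θ θ' x
  · refine ((((hasDerivAt_gaussAvg_angle hf hθ x).const_mul l).add
      ((hasDerivAt_interpCoef hl0 hl θ).mul (hasDerivAt_gaussAvg_angle hg hθ x))).exp).congr_deriv ?_
    simp only [interpExponent, gaussAvgAngleDeriv, Pi.add_apply, Pi.mul_apply]
    ring

/-- After integration by parts the f and g terms combine into sin θ cos θ ‖Γ‖², where Γ = l P∇f + a
P∇g is the averaged gradient. The differential equation for a supplies exactly the term -4(l + a)² P
g that dominates it. -/
theorem integral_exp_interpExponent_deriv_nonpos (hg0 : ∀ x, 0 ≤ g x)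
    (hfg : ∀ x, ‖fderiv ℝ f x‖ ≤ 2 * √(g x)) (hgg : ∀ x, ‖fderiv ℝ g x‖ ≤ 2 * √(g x))
    {θ : ℝ} (hc : 0 < Real.cos θ) (hs : 0 ≤ Real.sin θ) :
    ∫ x, Real.exp (interpExponent l f g θ x) * (l * gaussAvgAngleDeriv f θ x +
      (interpCoef l θ * gaussAvgAngleDeriv g θ x -
        4 * (Real.sin θ * Real.cos θ) * (l + interpCoef l θ) ^ 2 * gaussAvg g θ x))
        ∂stdGaussian E ≤ 0 := by
  obtain ⟨K, hK, h1, h2, h3⟩ := exists_bounds_interpExponent hl0 hl hf hg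
  have hi := (hasDerivAt_integral_exp_interpExponent hl0 hl hf hg hc.ne').1
  set a := interpCoef l θ
  have ha : 0 ≤ a := interpCoef_nonneg hl0 hl θ
  set U := interpExponent l f g θ
  set φ : E → ℝ := fun x => Real.exp (U x)
  set Γ : E → E →L[ℝ] ℝ := fun x => l • gaussAvgFDeriv f θ x + a • gaussAvgFDeriv g θ x
  have hφ : ExpLipschitz (Real.exp K * K) K φ := expLipschitz_exp hK (h1 θ) (h3 θ)
  have hUd : ∀ x, HasFDerivAt U (Real.sin θ • Γ x) x := fun x => by
    refine (((hasFDerivAt_gaussAvg hf hc.ne' x).const_mul l).add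
      ((hasFDerivAt_gaussAvg hg hc.ne' x).const_mul a)).congr_fderiv ?_
    simp only [Γ, smul_add, smul_smul, mul_comm]
  have hφd : ∀ x, HasFDerivAt φ (φ x • Real.sin θ • Γ x) x := fun x => (hUd x).exp
  have hφd' : Differentiable ℝ φ := fun x => (hφd x).differentiableAt
  obtain ⟨f1, f2, f3⟩ := integral_mul_gaussAvgAngleDeriv hf (by positivity) hK hφ hφd' θ
  obtain ⟨g1, g2, g3⟩ := integral_mul_gaussAvgAngleDeriv hg (by positivity) hK hφ hφd' θ
  set T : (E →L[ℝ] ℝ) → E := fun L => (InnerProductSpace.toDual ℝ E).symm L with hT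
  set b := 4 * (Real.sin θ * Real.cos θ) * (l + a) ^ 2
  -- Obtained by subtraction: the full θ-derivative and its other two terms are already known to be
  -- integrable.
  have hi3 : Integrable (fun x => φ x * (b * gaussAvg g θ x)) (stdGaussian E) := by
    refine (((f1.const_mul l).add (g1.const_mul a)).sub hi).congr (.of_forall fun x => ?_)
    simp only [Pi.add_apply, Pi.sub_apply, φ]
    ring
  have hI : Integrable (fun x => l * (φ x * gaussAvgAngleDeriv f θ x) +
      a * (φ x * gaussAvgAngleDeriv g θ x)) (stdGaussian E) := (f1.const_mul l).add (g1.const_mul a)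
  have e1 : ∫ x, Real.exp (U x) * (l * gaussAvgAngleDeriv f θ x +
      (a * gaussAvgAngleDeriv g θ x - b * gaussAvg g θ x)) ∂stdGaussian E =
      l * ∫ x, φ x * gaussAvgAngleDeriv f θ x ∂stdGaussian E +
      a * ∫ x, φ x * gaussAvgAngleDeriv g θ x ∂stdGaussian E -
      ∫ x, φ x * (b * gaussAvg g θ x) ∂stdGaussian E := by
    rw [← integral_const_mul, ← integral_const_mul, ← integral_add (f1.const_mul l)
      (g1.const_mul a), ← integral_sub hI hi3]
    refine integral_congr_ae (.of_forall fun x => ?_)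
    simp only [φ]
    ring
  have hf2 := (f2.const_mul (Real.cos θ)).const_mul l
  have hg2 := (g2.const_mul (Real.cos θ)).const_mul a
  have hfg2 : Integrable (fun x => l * (Real.cos θ * fderiv ℝ φ x (T (gaussAvgFDeriv f θ x))) +
      a * (Real.cos θ * fderiv ℝ φ x (T (gaussAvgFDeriv g θ x)))) (stdGaussian E) := hf2.add hg2
  rw [e1, f3, g3, ← integral_const_mul (Real.cos θ), ← integral_const_mul (Real.cos θ),
    ← integral_const_mul l, ← integral_const_mul a, ← integral_add hf2 hg2,
    ← integral_sub hfg2 hi3]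
  refine integral_nonpos fun x => ?_
  simp only [Pi.zero_apply]
  have hTadd : l * Γ x (T (gaussAvgFDeriv f θ x)) + a * Γ x (T (gaussAvgFDeriv g θ x)) =
      ‖Γ x‖ ^ 2 := by
    have e2 : T (Γ x) = l • T (gaussAvgFDeriv f θ x) + a • T (gaussAvgFDeriv g θ x) := by
      simp [hT, Γ]
    have e3 : Γ x (T (Γ x)) = ‖Γ x‖ ^ 2 := by
      have h5 : ⟪T (Γ x), T (Γ x)⟫ = Γ x (T (Γ x)) := InnerProductSpace.toDual_symm_apply
      rw [← h5, real_inner_self_eq_norm_sq]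
      simp [hT]
    rw [← e3, e2, map_add, map_smul, map_smul, smul_eq_mul, smul_eq_mul]
  have hA : 0 ≤ gaussAvg g θ x := integral_nonneg fun z => hg0 _
  -- The gradients of f and g obey the same bound in terms of g, so the weights l and a simply add;
  -- this is why the system closes.
  have hΓ : ‖Γ x‖ ≤ (l + a) * (2 * √(gaussAvg g θ x)) := by
    refine (norm_add_le _ _).trans ?_
    rw [norm_smul, norm_smul, Real.norm_of_nonneg hl0, Real.norm_of_nonneg ha, add_mul]
    exact add_le_add
      (mul_le_mul_of_nonneg_left (norm_gaussAvgFDeriv_le hg hg0 hfg θ x) hl0)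
      (mul_le_mul_of_nonneg_left (norm_gaussAvgFDeriv_le hg hg0 hgg θ x) ha)
  have hΓ2 : ‖Γ x‖ ^ 2 ≤ 4 * (l + a) ^ 2 * gaussAvg g θ x := by
    calc ‖Γ x‖ ^ 2 ≤ ((l + a) * (2 * √(gaussAvg g θ x))) ^ 2 := by gcongr
      _ = 4 * (l + a) ^ 2 * √(gaussAvg g θ x) ^ 2 := by ring
      _ = _ := by rw [Real.sq_sqrt hA]
  rw [(hφd x).fderiv]
  simp only [smul_apply, smul_eq_mul]
  have hφ0 : 0 < φ x := Real.exp_pos _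
  have e4 : l * (Real.cos θ * (φ x * (Real.sin θ * Γ x (T (gaussAvgFDeriv f θ x))))) +
      a * (Real.cos θ * (φ x * (Real.sin θ * Γ x (T (gaussAvgFDeriv g θ x))))) -
      φ x * (b * gaussAvg g θ x) =
      φ x * (Real.sin θ * Real.cos θ) * (‖Γ x‖ ^ 2 - 4 * (l + a) ^ 2 * gaussAvg g θ x) := by
    rw [← hTadd]; simp only [b]; ring
  refine e4.trans_le (mul_nonpos_of_nonneg_of_nonpos (by positivity) (by linarith))

/-- **Exponential moment bound** for a function whose squared gradient is dominated by a function
`4 g` with the same gradient bound. -/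
theorem integral_exp_mul_stdGaussian_le (hg0 : ∀ x, 0 ≤ g x)
    (hfg : ∀ x, ‖fderiv ℝ f x‖ ≤ 2 * √(g x)) (hgg : ∀ x, ‖fderiv ℝ g x‖ ≤ 2 * √(g x)) :
    Integrable (fun x => Real.exp (l * f x)) (stdGaussian E) ∧
    ∫ x, Real.exp (l * f x) ∂stdGaussian E ≤
      Real.exp (l * ∫ x, f x ∂stdGaussian E +
        2 * l ^ 2 / (1 - 2 * l) * ∫ x, g x ∂stdGaussian E) := by
  -- At θ = π/2 there is no averaging left and differentiability may fail, so the endpoint is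
  -- reached by continuity alone.
  have hanti : AntitoneOn (fun θ => ∫ x, Real.exp (interpExponent l f g θ x) ∂stdGaussian E)
      (Set.Icc 0 (Real.pi / 2)) := by
    have hd : ∀ θ ∈ interior (Set.Icc 0 (Real.pi / 2)), 0 < Real.cos θ ∧ 0 ≤ Real.sin θ := by
      intro θ hθ
      rw [interior_Icc] at hθ
      exact ⟨Real.cos_pos_of_mem_Ioo ⟨by linarith [hθ.1, Real.pi_pos], hθ.2⟩,
        Real.sin_nonneg_of_nonneg_of_le_pi hθ.1.le (by linarith [hθ.2, Real.pi_pos])⟩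
    refine antitoneOn_of_deriv_nonpos (convex_Icc _ _)
      (continuous_integral_exp_interpExponent hl0 hl hf hg).continuousOn
      (fun θ hθ => (hasDerivAt_integral_exp_interpExponent hl0 hl hf hg
        (hd θ hθ).1.ne').2.differentiableAt.differentiableWithinAt) (fun θ hθ => ?_)
    rw [(hasDerivAt_integral_exp_interpExponent hl0 hl hf hg (hd θ hθ).1.ne').2.deriv]
    exact integral_exp_interpExponent_deriv_nonpos hl0 hl hf hg hg0 hfg hgg (hd θ hθ).1 (hd θ hθ).2
  have hpi : 0 ≤ Real.pi / 2 := by positivity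
  have h := hanti (Set.left_mem_Icc.2 hpi) (Set.right_mem_Icc.2 hpi) hpi
  have e1 : ∀ x, interpExponent l f g (Real.pi / 2) x = l * f x := fun x => by
    simp [interpExponent, interpCoef, gaussAvg, ContinuousLinearMap.rotation_apply]
  -- At θ = 0 the averages are constants, and the coefficient is l/(1 - 2l) - l = 2l²/(1 - 2l).
  have e0 : ∀ x, interpExponent l f g 0 x = l * ∫ x, f x ∂stdGaussian E +
        2 * l ^ 2 / (1 - 2 * l) * ∫ x, g x ∂stdGaussian E := fun x => by
    have : 1 - 2 * l ≠ 0 := by linarith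
    simp only [interpExponent, interpCoef, gaussAvg, ContinuousLinearMap.rotation_apply,
      Real.cos_zero, Real.sin_zero, one_smul, zero_smul, add_zero, one_pow, mul_one]
    congr 2
    rw [eq_div_iff this, sub_mul, div_mul_cancel₀ _ this]
    ring
  refine ⟨?_, ?_⟩
  · obtain ⟨K, hK, h1, h2, h3⟩ := exists_bounds_interpExponent hl0 hl hf hg
    have := (expLipschitz_exp hK (h1 (Real.pi / 2)) (h3 (Real.pi / 2))).integrable_stdGaussian
      (by positivity)
    simpa only [e1] using this
  · simpa only [e1, e0, integral_const, probReal_univ, one_smul] using h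

end

end ProbabilityTheory

/-! ### Geometry of the projection: the displacement as half the gradient of the likelihood ratio -/

namespace SeqModel

variable {n : ℕ}

/-- The displacement `Π_K(μ₀ + x) - μ₀` caused by the perturbation `x` of the point `μ₀`. -/
noncomputable def displacement (K : Set (EuclideanSpace ℝ (Fin n)))
    (μ₀ x : EuclideanSpace ℝ (Fin n)) : EuclideanSpace ℝ (Fin n) :=
  proj K (μ₀ + x) - μ₀

/-- The likelihood ratio statistic as a function of the perturbation `x` of the point `μ₀`. -/
noncomputable def excess (K : Set (EuclideanSpace ℝ (Fin n)))
    (μ₀ x : EuclideanSpace ℝ (Fin n)) : ℝ :=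
  2 * ⟪x, displacement K μ₀ x⟫ - ‖displacement K μ₀ x‖ ^ 2

theorem err_eq (K : Set (EuclideanSpace ℝ (Fin n))) (μ₀ : EuclideanSpace ℝ (Fin n)) (σ : ℝ)
    (h : EuclideanSpace ℝ (Fin n)) : err K μ₀ σ h = ‖displacement K μ₀ (σ • h)‖ ^ 2 := rfl

theorem lrt_eq (K : Set (EuclideanSpace ℝ (Fin n))) (μ₀ : EuclideanSpace ℝ (Fin n)) (σ : ℝ)
    (h : EuclideanSpace ℝ (Fin n)) : lrt K μ₀ σ h = excess K μ₀ (σ • h) := by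
  have e : obs μ₀ σ h - lse K μ₀ σ h = σ • h - displacement K μ₀ (σ • h) := by
    simp only [obs, lse, displacement]; abel
  rw [lrt, e, obs, add_sub_cancel_left, norm_sub_sq_real, excess]
  ring

theorem excess_le (K : Set (EuclideanSpace ℝ (Fin n)))
    (μ₀ x : EuclideanSpace ℝ (Fin n)) : excess K μ₀ x ≤ ‖x‖ ^ 2 := by
  have h := norm_sub_sq_real x (displacement K μ₀ x)
  rw [excess]; linarith [sq_nonneg ‖x - displacement K μ₀ x‖]

section Projection

variable {K : Set (EuclideanSpace ℝ (Fin n))} {μ₀ : EuclideanSpace ℝ (Fin n)}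
  (hc : IsClosed K) (hK : Convex ℝ K) (hμ : μ₀ ∈ K)
include hc hK

theorem isLeastSquares_proj (hne : K.Nonempty) (y : EuclideanSpace ℝ (Fin n)) :
    IsLeastSquares K y (proj K y) :=
  (isLeastSquares_iff_eq_proj hc hK hne y _).2 rfl

theorem inner_sub_proj_le_zero {q : EuclideanSpace ℝ (Fin n)} (hq : q ∈ K)
    (y : EuclideanSpace ℝ (Fin n)) : ⟪y - proj K y, q - proj K y⟫ ≤ 0 := by
  have hne : K.Nonempty := ⟨q, hq⟩
  obtain ⟨hp, hmin⟩ := isLeastSquares_proj hc hK hne y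
  obtain ⟨p', hp', hmin'⟩ := exists_norm_eq_iInf_of_complete_convex hne hc.isComplete hK y
  have hls : IsLeastSquares K y p' := by
    refine ⟨hp', fun r hr => ?_⟩
    gcongr
    rw [hmin']
    exact ciInf_le ⟨0, by rintro _ ⟨w, rfl⟩; exact norm_nonneg _⟩ (⟨r, hr⟩ : K)
  rw [isLeastSquares_iff_eq_proj hc hK hne] at hls
  rw [hls] at hmin' hp'
  exact (norm_eq_iInf_iff_real_inner_le_zero hK hp').1 hmin' q hq

/-- Firm nonexpansiveness: add the obtuse-angle inequalities at the two projections, each tested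
against the other. -/
theorem norm_proj_sub_proj_sq_le (hne : K.Nonempty) (x y : EuclideanSpace ℝ (Fin n)) :
    ‖proj K x - proj K y‖ ^ 2 ≤ ⟪x - y, proj K x - proj K y⟫ := by
  have h1 := inner_sub_proj_le_zero hc hK (isLeastSquares_proj hc hK hne y).1 x
  have h2 := inner_sub_proj_le_zero hc hK (isLeastSquares_proj hc hK hne x).1 y
  rw [← real_inner_self_eq_norm_sq]
  simp only [inner_sub_left, inner_sub_right] at h1 h2 ⊢
  linarith

theorem lipschitzWith_proj (hne : K.Nonempty) : LipschitzWith 1 (proj K) := by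
  refine LipschitzWith.of_dist_le_mul fun x y => ?_
  rw [dist_eq_norm, dist_eq_norm, NNReal.coe_one, one_mul]
  have h1 := (norm_proj_sub_proj_sq_le hc hK hne x y).trans (real_inner_le_norm _ _)
  by_contra! h
  nlinarith [norm_nonneg (proj K x - proj K y), norm_nonneg (x - y)]

include hμ

theorem lipschitzWith_displacement : LipschitzWith 1 (displacement K μ₀) := by
  have h := lipschitzWith_proj hc hK ⟨μ₀, hμ⟩
  refine LipschitzWith.of_dist_le_mul fun x y => ?_
  have := h.dist_le_mul (μ₀ + x) (μ₀ + y)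
  rw [displacement, displacement, dist_sub_right]
  rwa [dist_add_left] at this

theorem norm_displacement_sq_le (x : EuclideanSpace ℝ (Fin n)) :
    ‖displacement K μ₀ x‖ ^ 2 ≤ ⟪x, displacement K μ₀ x⟫ := by
  have h := inner_sub_proj_le_zero hc hK hμ (μ₀ + x)
  rw [← real_inner_self_eq_norm_sq]
  have e1 : μ₀ + x - proj K (μ₀ + x) = x - displacement K μ₀ x := by rw [displacement]; abel
  have e2 : μ₀ - proj K (μ₀ + x) = -displacement K μ₀ x := by rw [displacement]; abel
  rw [e1, e2, inner_neg_right, inner_sub_left] at h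
  linarith

theorem norm_displacement_le (x : EuclideanSpace ℝ (Fin n)) : ‖displacement K μ₀ x‖ ≤ ‖x‖ := by
  have h1 := (norm_displacement_sq_le hc hK hμ x).trans (real_inner_le_norm _ _)
  by_contra! h
  nlinarith [norm_nonneg (displacement K μ₀ x), norm_nonneg x]

theorem norm_displacement_sq_le_excess (x : EuclideanSpace ℝ (Fin n)) :
    ‖displacement K μ₀ x‖ ^ 2 ≤ excess K μ₀ x := by
  have := norm_displacement_sq_le hc hK hμ x
  rw [excess]; linarith

theorem excess_nonneg (x : EuclideanSpace ℝ (Fin n)) : 0 ≤ excess K μ₀ x :=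
  (sq_nonneg _).trans (norm_displacement_sq_le_excess hc hK hμ x)

/-- The projection of μ₀ + x is a competitor in the minimization for μ₀ + y. Hence the excess is
convex with subgradient twice the displacement. -/
theorem two_inner_displacement_le (x y : EuclideanSpace ℝ (Fin n)) :
    2 * ⟪y - x, displacement K μ₀ x⟫ ≤ excess K μ₀ y - excess K μ₀ x := by
  have hne : K.Nonempty := ⟨μ₀, hμ⟩
  have h := (isLeastSquares_proj hc hK hne (μ₀ + y)).2 _
    (isLeastSquares_proj hc hK hne (μ₀ + x)).1
  have e1 : ∀ w, μ₀ + y - proj K (μ₀ + w) = y - displacement K μ₀ w := fun w => by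
    rw [displacement]; abel
  rw [e1, e1, norm_sub_sq_real, norm_sub_sq_real] at h
  simp only [excess, inner_sub_left]
  linarith

/-- The subgradient inequality with the points exchanged, where nonexpansiveness allows the
displacement at y to be replaced by the one at x at quadratic cost. With the lower bound this forces
differentiability. -/
theorem excess_sub_le (x y : EuclideanSpace ℝ (Fin n)) :
    excess K μ₀ y - excess K μ₀ x ≤ 2 * ⟪y - x, displacement K μ₀ x⟫ + 2 * ‖y - x‖ ^ 2 := by
  have h1 := two_inner_displacement_le hc hK hμ y x
  have h2 : ⟪y - x, displacement K μ₀ y - displacement K μ₀ x⟫ ≤ ‖y - x‖ * ‖y - x‖ := by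
    refine (real_inner_le_norm _ _).trans ?_
    gcongr
    simpa using (lipschitzWith_displacement hc hK hμ).norm_sub_le y x
  rw [← neg_sub y x, inner_neg_left] at h1
  rw [inner_sub_right] at h2
  nlinarith

theorem hasFDerivAt_excess (x : EuclideanSpace ℝ (Fin n)) :
    HasFDerivAt (excess K μ₀) ((2 : ℝ) • innerSL ℝ (displacement K μ₀ x)) x := by
  refine HasFDerivAt.of_isLittleO (Asymptotics.isLittleO_iff.2 fun c hc0 => ?_)
  filter_upwards [Metric.ball_mem_nhds x (half_pos hc0)] with y hy
  rw [Metric.mem_ball, dist_eq_norm] at hy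
  have h1 := two_inner_displacement_le hc hK hμ x y
  have h2 := excess_sub_le hc hK hμ x y
  have e : ((2 : ℝ) • innerSL ℝ (displacement K μ₀ x)) (y - x) =
      2 * ⟪y - x, displacement K μ₀ x⟫ := by
    rw [smul_apply, innerSL_apply_apply ℝ, smul_eq_mul, real_inner_comm]
  rw [e, Real.norm_of_nonneg (by linarith)]
  nlinarith [norm_nonneg (y - x)]

/-- The excess grows quadratically in general; bounded displacement is what makes it globally
Lipschitz, as the interpolation requires. -/
theorem abs_excess_sub_le {R : ℝ} (hR : ∀ x, ‖displacement K μ₀ x‖ ≤ R)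
    (x y : EuclideanSpace ℝ (Fin n)) : |excess K μ₀ x - excess K μ₀ y| ≤ 2 * R * ‖x - y‖ := by
  have h1 := two_inner_displacement_le hc hK hμ x y
  have h2 := two_inner_displacement_le hc hK hμ y x
  have h3 : ∀ a b w, -⟪a - b, displacement K μ₀ w⟫ ≤ R * ‖a - b‖ := fun a b w => by
    rw [← inner_neg_left]
    refine (real_inner_le_norm _ _).trans ?_
    rw [norm_neg, mul_comm]
    gcongr
    exact hR w
  have h4 := h3 y x x
  have h5 := h3 x y y
  rw [norm_sub_rev y x] at h4
  rw [abs_le]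
  constructor <;> linarith

theorem abs_norm_displacement_sq_sub_le (x y : EuclideanSpace ℝ (Fin n)) :
    |‖displacement K μ₀ x‖ ^ 2 - ‖displacement K μ₀ y‖ ^ 2| ≤
      (‖displacement K μ₀ x‖ + ‖displacement K μ₀ y‖) * ‖x - y‖ := by
  rw [sq_sub_sq, abs_mul, abs_of_nonneg (by positivity)]
  gcongr
  refine (abs_norm_sub_norm_le _ _).trans ?_
  simpa using (lipschitzWith_displacement hc hK hμ).norm_sub_le x y

/-- Only the local Lipschitz constant is estimated, so differentiability of the displacement is not
needed: ‖D(y)‖ + ‖D(x)‖ ≤ 2‖D(x)‖ + ε for y within ε of x. -/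
theorem norm_fderiv_norm_displacement_sq_le (x : EuclideanSpace ℝ (Fin n)) :
    ‖fderiv ℝ (fun x => ‖displacement K μ₀ x‖ ^ 2) x‖ ≤ 2 * ‖displacement K μ₀ x‖ := by
  refine le_of_forall_pos_le_add fun ε hε => ?_
  refine norm_fderiv_le_of_lip' ℝ (by positivity) ?_
  filter_upwards [Metric.ball_mem_nhds x hε] with y hy
  rw [Metric.mem_ball, dist_eq_norm] at hy
  refine (abs_norm_displacement_sq_sub_le hc hK hμ y x).trans ?_
  have h1 := (lipschitzWith_displacement hc hK hμ).norm_sub_le y x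
  rw [NNReal.coe_one, one_mul] at h1
  have h2 := norm_sub_norm_le (displacement K μ₀ y) (displacement K μ₀ x)
  exact mul_le_mul_of_nonneg_right (by linarith) (norm_nonneg _)

/-- Since ‖D(x)‖ ≤ ‖x‖ ≤ R, the projection already lies in the ball and stays optimal in the smaller
set. For each fixed noise vector the truncation is therefore eventually exact. -/
theorem displacement_inter_closedBall {R : ℝ} {x : EuclideanSpace ℝ (Fin n)} (hx : ‖x‖ ≤ R) :
    displacement (K ∩ Metric.closedBall μ₀ R) μ₀ x = displacement K μ₀ x := by
  have hR : 0 ≤ R := (norm_nonneg x).trans hx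
  have h := isLeastSquares_proj hc hK ⟨μ₀, hμ⟩ (μ₀ + x)
  rw [displacement, displacement, ← (isLeastSquares_iff_eq_proj (hc.inter Metric.isClosed_closedBall)
    (hK.inter (convex_closedBall μ₀ R)) ⟨μ₀, hμ, Metric.mem_closedBall_self hR⟩ _ _).1]
  refine ⟨⟨h.1, ?_⟩, fun q hq => h.2 q hq.1⟩
  rw [Metric.mem_closedBall, dist_eq_norm]
  exact (norm_displacement_le hc hK hμ x).trans hx

theorem norm_displacement_inter_closedBall_le {R : ℝ} (hR : 0 ≤ R)
    (x : EuclideanSpace ℝ (Fin n)) :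
    ‖displacement (K ∩ Metric.closedBall μ₀ R) μ₀ x‖ ≤ R := by
  have h := (isLeastSquares_proj (hc.inter Metric.isClosed_closedBall)
    (hK.inter (convex_closedBall μ₀ R)) ⟨μ₀, hμ, Metric.mem_closedBall_self hR⟩ (μ₀ + x)).1.2
  rwa [Metric.mem_closedBall, dist_eq_norm] at h

end Projection

end SeqModel

/-! ### Exponential moments of the likelihood ratio: truncation and limit -/

/-- Fatou's lemma. It delivers integrability of the limit as well, so no dominating function for the
exponentials is needed. -/
theorem integral_le_of_tendsto_of_nonneg {α : Type*} [MeasurableSpace α] {μ : Measure α}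
    {F : ℕ → α → ℝ} {f : α → ℝ} {b : ℕ → ℝ} {c : ℝ} (hF0 : ∀ k x, 0 ≤ F k x)
    (hFi : ∀ k, Integrable (F k) μ)
    (hlim : ∀ x, Filter.Tendsto (fun k => F k x) Filter.atTop (nhds (f x)))
    (hb : ∀ k, ∫ x, F k x ∂μ ≤ b k) (hbc : Filter.Tendsto b Filter.atTop (nhds c)) :
    Integrable f μ ∧ ∫ x, f x ∂μ ≤ c := by
  have hf0 : ∀ x, 0 ≤ f x := fun x => ge_of_tendsto' (hlim x) fun k => hF0 k x
  have hc0 : 0 ≤ c := ge_of_tendsto' hbc fun k => (integral_nonneg (hF0 k)).trans (hb k)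
  have hfm : AEStronglyMeasurable f μ :=
    aestronglyMeasurable_of_tendsto_ae Filter.atTop (fun k => (hFi k).aestronglyMeasurable)
      (.of_forall hlim)
  have h1 : ∫⁻ x, ENNReal.ofReal (f x) ∂μ ≤ ENNReal.ofReal c := by
    calc ∫⁻ x, ENNReal.ofReal (f x) ∂μ
        = ∫⁻ x, Filter.liminf (fun k => ENNReal.ofReal (F k x)) Filter.atTop ∂μ := by
          refine lintegral_congr fun x => ?_
          exact ((ENNReal.continuous_ofReal.tendsto _).comp (hlim x)).liminf_eq.symm
      _ ≤ Filter.liminf (fun k => ∫⁻ x, ENNReal.ofReal (F k x) ∂μ) Filter.atTop :=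
          lintegral_liminf_le' fun k => (hFi k).aemeasurable.ennreal_ofReal
      _ ≤ Filter.liminf (fun k => ENNReal.ofReal (b k)) Filter.atTop := by
          refine Filter.liminf_le_liminf (.of_forall fun k => ?_)
          rw [← ofReal_integral_eq_lintegral_ofReal (hFi k) (.of_forall (hF0 k))]
          exact ENNReal.ofReal_le_ofReal (hb k)
      _ = ENNReal.ofReal c := ((ENNReal.continuous_ofReal.tendsto _).comp hbc).liminf_eq
  have hfi : Integrable f μ := ⟨hfm, by
    rw [hasFiniteIntegral_iff_ofReal (.of_forall hf0)]
    exact h1.trans_lt ENNReal.ofReal_lt_top⟩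
  refine ⟨hfi, ?_⟩
  rw [integral_eq_lintegral_of_nonneg_ae (.of_forall hf0) hfm]
  exact ENNReal.toReal_le_of_le_ofReal hc0 h1

namespace SeqModel

variable {n : ℕ} {K : Set (EuclideanSpace ℝ (Fin n))} {μ₀ : EuclideanSpace ℝ (Fin n)}
  (hc : IsClosed K) (hK : Convex ℝ K) (hμ : μ₀ ∈ K)
include hc hK hμ

theorem continuous_excess : Continuous (excess K μ₀) :=
  continuous_iff_continuousAt.2 fun x => (hasFDerivAt_excess hc hK hμ x).continuousAt

theorem continuous_displacement : Continuous (displacement K μ₀) :=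
  (lipschitzWith_displacement hc hK hμ).continuous

theorem continuous_lrt (σ : ℝ) : Continuous (lrt K μ₀ σ) := by
  simp only [funext (lrt_eq K μ₀ σ)]
  exact (continuous_excess hc hK hμ).comp (continuous_const_smul σ)

theorem continuous_err (σ : ℝ) : Continuous (err K μ₀ σ) := by
  simp only [funext (err_eq K μ₀ σ)]
  exact ((continuous_displacement hc hK hμ).comp (continuous_const_smul σ)).norm.pow 2

theorem abs_lrt_le (σ : ℝ) (h : EuclideanSpace ℝ (Fin n)) : |lrt K μ₀ σ h| ≤ σ ^ 2 * ‖h‖ ^ 2 := by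
  rw [lrt_eq, abs_of_nonneg (excess_nonneg hc hK hμ _)]
  refine (excess_le K μ₀ _).trans_eq ?_
  rw [norm_smul, mul_pow, Real.norm_eq_abs, sq_abs]

theorem abs_err_le (σ : ℝ) (h : EuclideanSpace ℝ (Fin n)) : |err K μ₀ σ h| ≤ σ ^ 2 * ‖h‖ ^ 2 := by
  rw [err_eq, abs_of_nonneg (sq_nonneg _)]
  calc _ ≤ ‖σ • h‖ ^ 2 := by gcongr; exact norm_displacement_le hc hK hμ _
    _ = _ := by rw [norm_smul, mul_pow, Real.norm_eq_abs, sq_abs]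

omit hc hK hμ in
theorem integrable_sq_mul_norm_sq (σ : ℝ) :
    Integrable (fun h : EuclideanSpace ℝ (Fin n) => σ ^ 2 * ‖h‖ ^ 2) (gauss n) :=
  ((IsGaussian.memLp_two_id (μ := gauss n)).integrable_norm_pow two_ne_zero).const_mul _

theorem integrable_lrt (σ : ℝ) : Integrable (lrt K μ₀ σ) (gauss n) :=
  (integrable_sq_mul_norm_sq σ).mono' (continuous_lrt hc hK hμ σ).aestronglyMeasurable
    (.of_forall fun h => abs_lrt_le hc hK hμ σ h)

theorem integrable_err (σ : ℝ) : Integrable (err K μ₀ σ) (gauss n) :=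
  (integrable_sq_mul_norm_sq σ).mono' (continuous_err hc hK hμ σ).aestronglyMeasurable
    (.of_forall fun h => abs_err_le hc hK hμ σ h)

theorem integral_exp_le_of_displacement_le {R : ℝ} (hR : ∀ x, ‖displacement K μ₀ x‖ ≤ R)
    {σ : ℝ} (hσ : 0 < σ) {k : ℝ} (hk : |k| < 1 / 2) :
    Integrable (fun h => Real.exp (k * (lrt K μ₀ σ h / σ ^ 2))) (gauss n) ∧
    ∫ h, Real.exp (k * (lrt K μ₀ σ h / σ ^ 2)) ∂gauss n ≤
      Real.exp (k * (meanLrt K μ₀ σ / σ ^ 2) +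
        2 * k ^ 2 / (1 - 2 * |k|) * (meanErr K μ₀ σ / σ ^ 2)) := by
  have hR0 : 0 ≤ R := (norm_nonneg _).trans (hR 0)
  -- The interpolation needs a nonnegative parameter, so the sign of k is moved into f; the gradient
  -- bound does not see it.
  obtain ⟨ε, hε, hεk⟩ : ∃ ε : ℝ, |ε| = 1 ∧ |k| * ε = k := by
    rcases le_total 0 k with h | h
    · exact ⟨1, by simp, by rw [abs_of_nonneg h, mul_one]⟩
    · exact ⟨-1, by simp, by rw [abs_of_nonpos h]; ring⟩
  set f : EuclideanSpace ℝ (Fin n) → ℝ := fun h => ε * (lrt K μ₀ σ h / σ ^ 2) with hf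
  set g : EuclideanSpace ℝ (Fin n) → ℝ := fun h => err K μ₀ σ h / σ ^ 2 with hg
  have hσ0 : (0 : ℝ) < σ ^ 2 := by positivity
  have hsm : ∀ x y : EuclideanSpace ℝ (Fin n), ‖σ • x - σ • y‖ = σ * ‖x - y‖ := fun x y => by
    rw [← smul_sub, norm_smul, Real.norm_of_nonneg hσ.le]
  have hC : 0 ≤ 2 * R / σ := by positivity
  have hCc : ((2 * R / σ).toNNReal : ℝ) = 2 * R / σ := Real.coe_toNNReal _ hC
  have hfL : LipschitzWith (2 * R / σ).toNNReal f := by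
    refine LipschitzWith.of_dist_le_mul fun x y => ?_
    rw [dist_eq_norm, dist_eq_norm, Real.norm_eq_abs, hCc, hf]
    simp only
    rw [← mul_sub, ← sub_div, abs_mul, hε, one_mul, abs_div, abs_of_pos hσ0, lrt_eq, lrt_eq,
      div_le_iff₀ hσ0]
    refine (abs_excess_sub_le hc hK hμ hR _ _).trans_eq ?_
    rw [hsm]; field_simp
  have hgL : LipschitzWith (2 * R / σ).toNNReal g := by
    refine LipschitzWith.of_dist_le_mul fun x y => ?_
    rw [dist_eq_norm, dist_eq_norm, Real.norm_eq_abs, hCc, hg]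
    simp only
    rw [← sub_div, abs_div, abs_of_pos hσ0, err_eq, err_eq, div_le_iff₀ hσ0]
    refine (abs_norm_displacement_sq_sub_le hc hK hμ _ _).trans ?_
    calc _ ≤ (R + R) * ‖σ • x - σ • y‖ := by gcongr <;> exact hR _
      _ = _ := by rw [hsm]; field_simp; ring
  have hg0 : ∀ x, 0 ≤ g x := fun x => by simp only [hg, err_eq]; positivity
  have hsq : ∀ x, √(g x) = ‖displacement K μ₀ (σ • x)‖ / σ := fun x => by
    simp only [hg, err_eq]
    rw [← div_pow, Real.sqrt_sq (by positivity)]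
  have hfg : ∀ x, ‖fderiv ℝ f x‖ ≤ 2 * √(g x) := fun x => by
    have h1 : HasFDerivAt f ((ε / σ ^ 2) • ((2 : ℝ) • innerSL ℝ (displacement K μ₀ (σ • x))).comp
        (σ • ContinuousLinearMap.id ℝ (EuclideanSpace ℝ (Fin n)))) x := by
      have h2 := ((hasFDerivAt_excess hc hK hμ (σ • x)).comp x
        ((hasFDerivAt_id x).const_smul σ)).const_mul (ε / σ ^ 2)
      refine h2.congr_of_eventuallyEq (.of_forall fun y => ?_)
      simp only [hf, lrt_eq, Function.comp]
      ring
    rw [h1.fderiv, hsq, ContinuousLinearMap.comp_smul, ContinuousLinearMap.comp_id, norm_smul,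
      norm_smul, norm_smul, innerSL_apply_norm, norm_div, Real.norm_eq_abs ε, hε,
      Real.norm_of_nonneg hσ.le, Real.norm_of_nonneg hσ0.le, Real.norm_ofNat]
    exact le_of_eq (by field_simp)
  have hgg : ∀ x, ‖fderiv ℝ g x‖ ≤ 2 * √(g x) := fun x => by
    have e : g = (σ ^ 2)⁻¹ • fun x => (fun y => ‖displacement K μ₀ y‖ ^ 2) (σ • x) := by
      ext x; simp only [hg, err_eq, Pi.smul_apply, smul_eq_mul]; ring
    have e' : fderiv ℝ g x =
        (σ ^ 2)⁻¹ • σ • fderiv ℝ (fun y => ‖displacement K μ₀ y‖ ^ 2) (σ • x) := by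
      rw [e, fderiv_const_smul_field, Pi.smul_apply]
      exact congrArg _ (fderiv_comp_smul (f := fun y => ‖displacement K μ₀ y‖ ^ 2) σ)
    have h1 := norm_fderiv_norm_displacement_sq_le hc hK hμ (σ • x)
    rw [e', hsq, norm_smul, norm_smul, Real.norm_of_nonneg hσ.le,
      Real.norm_of_nonneg (by positivity)]
    calc _ ≤ (σ ^ 2)⁻¹ * (σ * (2 * ‖displacement K μ₀ (σ • x)‖)) := by gcongr
      _ = _ := by field_simp
  have key := integral_exp_mul_stdGaussian_le (abs_nonneg k) hk hfL hgL hg0 hfg hgg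
  have e1 : ∀ x, |k| * f x = k * (lrt K μ₀ σ x / σ ^ 2) := fun x => by
    simp only [hf]; rw [← mul_assoc, hεk]
  have e2 : |k| * ∫ x, f x ∂gauss n = k * (meanLrt K μ₀ σ / σ ^ 2) := by
    rw [← integral_const_mul]
    simp only [e1]
    rw [integral_const_mul, integral_div, meanLrt]
  simp only [e1, e2, sq_abs] at key
  refine ⟨key.1, key.2.trans_eq ?_⟩
  rw [meanErr, ← integral_div]

theorem integral_exp_mul_lrt_le {σ : ℝ} (hσ : 0 < σ) {k : ℝ} (hk : |k| < 1 / 2) :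
    Integrable (fun h => Real.exp (k * (lrt K μ₀ σ h / σ ^ 2))) (gauss n) ∧
    ∫ h, Real.exp (k * (lrt K μ₀ σ h / σ ^ 2)) ∂gauss n ≤
      Real.exp (k * (meanLrt K μ₀ σ / σ ^ 2) +
        2 * k ^ 2 / (1 - 2 * |k|) * (meanErr K μ₀ σ / σ ^ 2)) := by
  set B : ℕ → Set (EuclideanSpace ℝ (Fin n)) := fun N => K ∩ Metric.closedBall μ₀ N
  have hBc : ∀ N, IsClosed (B N) := fun N => hc.inter Metric.isClosed_closedBall
  have hBK : ∀ N, Convex ℝ (B N) := fun N => hK.inter (convex_closedBall μ₀ N)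
  have hBμ : ∀ N, μ₀ ∈ B N := fun N => ⟨hμ, Metric.mem_closedBall_self N.cast_nonneg⟩
  have hev : ∀ h : EuclideanSpace ℝ (Fin n), ∀ᶠ N in Filter.atTop,
      displacement (B N) μ₀ (σ • h) = displacement K μ₀ (σ • h) := fun h => by
    obtain ⟨N₀, hN₀⟩ := exists_nat_ge ‖σ • h‖
    filter_upwards [Filter.eventually_ge_atTop N₀] with N hN
    exact displacement_inter_closedBall hc hK hμ (hN₀.trans (by exact_mod_cast hN))
  have hlrt : ∀ h, Filter.Tendsto (fun N => lrt (B N) μ₀ σ h) Filter.atTop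
      (nhds (lrt K μ₀ σ h)) := fun h => by
    refine tendsto_const_nhds.congr' ?_
    filter_upwards [hev h] with N hN
    rw [lrt_eq, lrt_eq, excess, excess, hN]
  have herr : ∀ h, Filter.Tendsto (fun N => err (B N) μ₀ σ h) Filter.atTop
      (nhds (err K μ₀ σ h)) := fun h => by
    refine tendsto_const_nhds.congr' ?_
    filter_upwards [hev h] with N hN
    rw [err_eq, err_eq, hN]
  have h1 : Filter.Tendsto (fun N => meanLrt (B N) μ₀ σ) Filter.atTop
      (nhds (meanLrt K μ₀ σ)) :=
    tendsto_integral_of_dominated_convergence _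
      (fun N => (continuous_lrt (hBc N) (hBK N) (hBμ N) σ).aestronglyMeasurable)
      (integrable_sq_mul_norm_sq σ)
      (fun N => .of_forall fun h => abs_lrt_le (hBc N) (hBK N) (hBμ N) σ h) (.of_forall hlrt)
  have h2 : Filter.Tendsto (fun N => meanErr (B N) μ₀ σ) Filter.atTop
      (nhds (meanErr K μ₀ σ)) :=
    tendsto_integral_of_dominated_convergence _
      (fun N => (continuous_err (hBc N) (hBK N) (hBμ N) σ).aestronglyMeasurable)
      (integrable_sq_mul_norm_sq σ)
      (fun N => .of_forall fun h => abs_err_le (hBc N) (hBK N) (hBμ N) σ h) (.of_forall herr)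
  have hN := fun N => integral_exp_le_of_displacement_le (hBc N) (hBK N) (hBμ N)
    (norm_displacement_inter_closedBall_le hc hK hμ N.cast_nonneg) hσ hk
  exact integral_le_of_tendsto_of_nonneg (fun N h => (Real.exp_pos _).le) (fun N => (hN N).1)
    (fun h => (Real.continuous_exp.tendsto _).comp (((hlrt h).div_const _).const_mul k))
    (fun N => (hN N).2)
    ((Real.continuous_exp.tendsto _).comp (((h1.div_const _).const_mul k).add
      ((h2.div_const _).const_mul _)))

/-- Exponential moments of the centered and rescaled likelihood ratio statistic. -/
theorem integral_exp_mul_lrt_sub_le {σ : ℝ} (hσ : 0 < σ) {k : ℝ} (hk : |k| < 1 / 2) :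
    Integrable (fun h => Real.exp (k * ((lrt K μ₀ σ h - meanLrt K μ₀ σ) / σ ^ 2))) (gauss n) ∧
    ∫ h, Real.exp (k * ((lrt K μ₀ σ h - meanLrt K μ₀ σ) / σ ^ 2)) ∂gauss n ≤
      Real.exp (2 * k ^ 2 / (1 - 2 * |k|) * (meanErr K μ₀ σ / σ ^ 2)) := by
  obtain ⟨h1, h2⟩ := integral_exp_mul_lrt_le hc hK hμ hσ hk
  have e : ∀ h, Real.exp (k * ((lrt K μ₀ σ h - meanLrt K μ₀ σ) / σ ^ 2)) =
      Real.exp (k * (lrt K μ₀ σ h / σ ^ 2)) * Real.exp (-(k * (meanLrt K μ₀ σ / σ ^ 2))) :=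
    fun h => by rw [← Real.exp_add]; ring_nf
  simp only [e]
  refine ⟨h1.mul_const _, ?_⟩
  rw [integral_mul_const]
  refine (mul_le_mul_of_nonneg_right h2 (Real.exp_pos _).le).trans_eq ?_
  rw [← Real.exp_add]; ring_nf

end SeqModel

/-! ### Variance and tail bounds -/

namespace SeqModel

variable {n : ℕ} {K : Set (EuclideanSpace ℝ (Fin n))} {μ₀ : EuclideanSpace ℝ (Fin n)}

theorem meanErr_nonneg (K : Set (EuclideanSpace ℝ (Fin n))) (μ₀ : EuclideanSpace ℝ (Fin n))
    (σ : ℝ) : 0 ≤ meanErr K μ₀ σ :=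
  integral_nonneg fun _ => sq_nonneg _

/-- This is 2 cosh x = 2 + 4 sinh²(x/2) together with |sinh u| ≥ |u|. -/
theorem two_add_sq_le_exp_add_exp_neg (x : ℝ) :
    2 + x ^ 2 ≤ Real.exp x + Real.exp (-x) := by
  have h1 : |x / 2| ≤ |Real.sinh (x / 2)| := by
    rw [Real.abs_sinh]; exact Real.self_le_sinh_iff.2 (abs_nonneg _)
  have h2 := sq_le_sq.2 h1
  rw [Real.sinh_eq] at h2
  have e1 : Real.exp x = Real.exp (x / 2) ^ 2 := by rw [← Real.exp_nat_mul]; ring_nf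
  have e2 : Real.exp (-x) = Real.exp (-(x / 2)) ^ 2 := by rw [← Real.exp_nat_mul]; ring_nf
  have e3 : Real.exp (x / 2) * Real.exp (-(x / 2)) = 1 := by rw [← Real.exp_add]; simp
  rw [e1, e2]
  linarith

section

variable (hc : IsClosed K) (hK : Convex ℝ K) (hμ : μ₀ ∈ K)
include hc hK hμ

theorem memLp_lrt (σ : ℝ) : MemLp (lrt K μ₀ σ) 2 (gauss n) := by
  have hm := (continuous_lrt hc hK hμ σ).aestronglyMeasurable (μ := gauss n)
  rw [memLp_two_iff_integrable_sq hm]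
  have h4 := (IsGaussian.memLp_id (gauss n) 4 (by simp)).integrable_norm_pow (p := 4)
    (by norm_num)
  refine (h4.const_mul (σ ^ 4)).mono' (hm.pow 2) (.of_forall fun h => ?_)
  rw [Real.norm_eq_abs, abs_pow]
  calc _ ≤ (σ ^ 2 * ‖h‖ ^ 2) ^ 2 := by gcongr; exact abs_lrt_le hc hK hμ σ h
    _ = _ := by simp only [id]; ring

theorem variance_lrt_le {σ : ℝ} (hσ : 0 < σ) :
    variance (lrt K μ₀ σ) (gauss n) ≤ 4 * σ ^ 2 * meanErr K μ₀ σ := by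
  set m := meanErr K μ₀ σ / σ ^ 2 with hm
  set T : EuclideanSpace ℝ (Fin n) → ℝ := fun h => (lrt K μ₀ σ h - meanLrt K μ₀ σ) / σ ^ 2
  have hσ0 : (0 : ℝ) < σ ^ 2 := by positivity
  have hm0 : 0 ≤ m := div_nonneg (meanErr_nonneg K μ₀ σ) hσ0.le
  have hTi : Integrable (fun h => T h ^ 2) (gauss n) := by
    have := ((memLp_lrt hc hK hμ σ).sub (memLp_const (meanLrt K μ₀ σ))).integrable_sq.div_const
      ((σ ^ 2) ^ 2)
    refine this.congr (.of_forall fun h => ?_)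
    simp only [Pi.sub_apply, T]; ring
  have hV : variance (lrt K μ₀ σ) (gauss n) = (σ ^ 2) ^ 2 * ∫ h, T h ^ 2 ∂gauss n := by
    rw [variance_eq_integral (continuous_lrt hc hK hμ σ).measurable.aemeasurable,
      ← integral_const_mul]
    refine integral_congr_ae (.of_forall fun h => ?_)
    simp only [T, meanLrt]
    field_simp
  -- Adding the exponential bounds at k and -k cancels the first-order term; after division by k²
  -- the right side tends to 4m as k decreases to 0.
  have hk : ∀ k : ℝ, 0 < k → k < 1 / 2 →
      ∫ h, T h ^ 2 ∂gauss n ≤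
        2 * (2 * m / (1 - 2 * k)) * Real.exp (2 * k ^ 2 / (1 - 2 * k) * m) := by
    intro k hk0 hk
    have hka : |k| = k := abs_of_pos hk0
    have hka' : |-k| = k := by rw [abs_neg, hka]
    obtain ⟨i1, b1⟩ := integral_exp_mul_lrt_sub_le hc hK hμ hσ (k := k) (by rwa [hka])
    obtain ⟨i2, b2⟩ := integral_exp_mul_lrt_sub_le hc hK hμ hσ (k := -k) (by rwa [hka'])
    rw [hka] at b1
    rw [hka', neg_sq] at b2
    set s := 2 * k ^ 2 / (1 - 2 * k) * m
    have h1 : 2 + k ^ 2 * ∫ h, T h ^ 2 ∂gauss n ≤ 2 * Real.exp s := by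
      have h2 : ∫ h, (2 + k ^ 2 * T h ^ 2) ∂gauss n ≤
          ∫ h, (Real.exp (k * T h) + Real.exp (-k * T h)) ∂gauss n := by
        refine integral_mono ((integrable_const _).add (hTi.const_mul _)) (i1.add i2) fun h => ?_
        have := two_add_sq_le_exp_add_exp_neg (k * T h)
        rw [mul_pow] at this
        simpa only [neg_mul] using this
      rw [integral_add (integrable_const _) (hTi.const_mul _), integral_const_mul,
        integral_const, probReal_univ, one_smul, integral_add i1 i2] at h2
      linarith
    have h3 : Real.exp s - 1 ≤ s * Real.exp s := by
      have := Real.one_sub_le_exp_neg s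
      have h4 : Real.exp (-s) * Real.exp s = 1 := by rw [← Real.exp_add]; simp
      nlinarith [Real.exp_pos s]
    have h5 : k ^ 2 * ∫ h, T h ^ 2 ∂gauss n ≤
        k ^ 2 * (2 * (2 * m / (1 - 2 * k)) * Real.exp s) := by
      have e : k ^ 2 * (2 * (2 * m / (1 - 2 * k)) * Real.exp s) = 2 * (s * Real.exp s) := by
        simp only [s]; ring
      rw [e]; linarith
    exact le_of_mul_le_mul_left h5 (by positivity)
  have hlim : Filter.Tendsto (fun k : ℝ => 2 * (2 * m / (1 - 2 * k)) *
      Real.exp (2 * k ^ 2 / (1 - 2 * k) * m)) (nhdsWithin 0 (Set.Ioi 0)) (nhds (4 * m)) := by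
    have hcont : ContinuousAt (fun k : ℝ => 2 * (2 * m / (1 - 2 * k)) *
        Real.exp (2 * k ^ 2 / (1 - 2 * k) * m)) 0 := by
      have h0 : (1 : ℝ) - 2 * 0 ≠ 0 := by norm_num
      fun_prop (disch := exact h0)
    have h := hcont.tendsto.mono_left (nhdsWithin_le_nhds (s := Set.Ioi 0))
    convert h using 2
    norm_num
    ring
  have hT4 : ∫ h, T h ^ 2 ∂gauss n ≤ 4 * m := by
    refine ge_of_tendsto hlim ?_
    filter_upwards [Ioo_mem_nhdsGT (show (0 : ℝ) < 1 / 2 by norm_num)] with k hk'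
    exact hk k hk'.1 hk'.2
  rw [hV]
  calc (σ ^ 2) ^ 2 * ∫ h, T h ^ 2 ∂gauss n ≤ (σ ^ 2) ^ 2 * (4 * m) := by gcongr
    _ = _ := by rw [hm]; field_simp

theorem integral_exp_standardized_lrt_le {σ : ℝ} (hσ : 0 < σ) {l : ℝ}
    (hl : l ^ 2 < meanErr K μ₀ σ / (8 * σ ^ 2)) :
    Integrable (fun h => Real.exp (l * ((lrt K μ₀ σ h - meanLrt K μ₀ σ) /
        (σ * √(meanErr K μ₀ σ))))) (gauss n) ∧
    ∫ h, Real.exp (l * ((lrt K μ₀ σ h - meanLrt K μ₀ σ) / (σ * √(meanErr K μ₀ σ)))) ∂gauss n ≤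
      Real.exp (4 * l ^ 2 / (1 - 8 * (σ ^ 2 / meanErr K μ₀ σ) * l ^ 2)) := by
  set m := meanErr K μ₀ σ
  have hσ0 : (0 : ℝ) < σ ^ 2 := by positivity
  -- A square lies strictly below m/(8σ²), which excludes the degenerate case m = 0.
  have hm : 0 < m := by
    by_contra! h
    have : m / (8 * σ ^ 2) ≤ 0 := div_nonpos_of_nonpos_of_nonneg h (by positivity)
    linarith [sq_nonneg l]
  have hs : 0 < √m := Real.sqrt_pos.2 hm
  have hs2 : √m ^ 2 = m := Real.sq_sqrt hm.le
  -- The value of k for which the scaling by σ² matches the standardization by σ√m. The hypothesis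
  -- becomes 8k² < 1, which implies |k| < 1/2.
  set k := l * σ / √m with hk
  have hk2 : k ^ 2 = σ ^ 2 / m * l ^ 2 := by
    rw [hk, div_pow, mul_pow, hs2]; ring
  have hk8 : 8 * k ^ 2 < 1 := by
    rw [lt_div_iff₀ (by positivity)] at hl
    rw [hk2, div_mul_eq_mul_div, ← mul_div_assoc, div_lt_one hm]
    linarith
  have hka : |k| < 1 / 2 := by
    rw [← sq_abs] at hk8
    nlinarith [abs_nonneg k]
  obtain ⟨i1, b1⟩ := integral_exp_mul_lrt_sub_le hc hK hμ hσ hka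
  have e : ∀ h, k * ((lrt K μ₀ σ h - meanLrt K μ₀ σ) / σ ^ 2) =
      l * ((lrt K μ₀ σ h - meanLrt K μ₀ σ) / (σ * √m)) := fun h => by
    rw [hk]; field_simp
  simp only [e] at i1 b1
  refine ⟨i1, b1.trans (Real.exp_le_exp.2 ?_)⟩
  have hk8' : 0 < 1 - 8 * |k| ^ 2 := by rw [sq_abs]; linarith
  have e2 : 2 * k ^ 2 / (1 - 2 * |k|) * (m / σ ^ 2) = 2 * l ^ 2 / (1 - 2 * |k|) := by
    rw [hk2]; field_simp
  have e3 : 1 - 8 * (σ ^ 2 / m) * l ^ 2 = 1 - 8 * |k| ^ 2 := by rw [sq_abs, hk2]; ring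
  -- What remains is 1 - 8k² ≤ 2(1 - 2|k|), equivalent to (4|k| - 1)² + 1 ≥ 0.
  rw [e2, e3, div_le_div_iff₀ (by linarith) hk8']
  nlinarith [sq_nonneg l, sq_nonneg (4 * |k| - 1), mul_nonneg (sq_nonneg l) (sq_nonneg (4 * |k| - 1))]

theorem measureReal_le_of_meanErr_pos {σ : ℝ} (hσ : 0 < σ) (hm : 0 < meanErr K μ₀ σ) {t : ℝ}
    (ht : 0 ≤ t) :
    (gauss n).real {h | √(σ ^ 2 * meanErr K μ₀ σ * t) + σ ^ 2 * t ≤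
      6⁻¹ * |lrt K μ₀ σ h - meanLrt K μ₀ σ|} ≤ 2 * Real.exp (-t) := by
  set m := meanErr K μ₀ σ
  set a := √m
  have ha : 0 < a := Real.sqrt_pos.2 hm
  have ha2 : a ^ 2 = m := Real.sq_sqrt hm.le
  set r := √t
  have hr : 0 ≤ r := Real.sqrt_nonneg t
  have hr2 : r ^ 2 = t := Real.sq_sqrt ht
  have hsq : √(σ ^ 2 * m * t) = σ * a * r := by
    rw [← ha2, ← hr2, ← mul_pow, ← mul_pow, Real.sqrt_sq (by positivity)]
  set V : EuclideanSpace ℝ (Fin n) → ℝ := fun h => (lrt K μ₀ σ h - meanLrt K μ₀ σ) / (σ * a)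
  -- the exponent `l = min (√t) (√m / σ) / 4`
  obtain ⟨l, hl0, hl1, hl2, hl3⟩ : ∃ l : ℝ, 0 ≤ l ∧ 16 * l ^ 2 ≤ m / σ ^ 2 ∧ 16 * l ^ 2 ≤ t ∧
      t ≤ 4 * l * (r + σ * t / a) := by
    rcases le_total r (a / σ) with h | h
    · refine ⟨r / 4, by positivity, ?_, by nlinarith, ?_⟩
      · rw [← ha2, ← div_pow]
        calc 16 * (r / 4) ^ 2 = r ^ 2 := by ring
          _ ≤ _ := by gcongr
      · have : 0 ≤ r * (σ * t / a) := by positivity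
        nlinarith
    · refine ⟨a / σ / 4, by positivity, ?_, ?_, ?_⟩
      · rw [← ha2, ← div_pow]; exact le_of_eq (by ring)
      · rw [← hr2]
        calc 16 * (a / σ / 4) ^ 2 = (a / σ) ^ 2 := by ring
          _ ≤ _ := by gcongr
      · have h1 : 0 ≤ a / σ * r := by positivity
        have h2 : a / σ * (σ * t / a) = t := by field_simp
        linarith
  have hl8 : l ^ 2 < m / (8 * σ ^ 2) := by
    have e : m / (8 * σ ^ 2) = m / σ ^ 2 / 8 := by field_simp
    have : 0 < m / σ ^ 2 := by positivity
    rw [e]; linarith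
  -- From 16l² ≤ m/σ² the denominator is at least 1/2, so the exponent is at most 8l² ≤ t/2.
  have hexp : Real.exp (4 * l ^ 2 / (1 - 8 * (σ ^ 2 / m) * l ^ 2)) ≤ Real.exp (t / 2) := by
    refine Real.exp_le_exp.2 ?_
    have h1 : 8 * (σ ^ 2 / m) * l ^ 2 ≤ 1 / 2 := by
      calc 8 * (σ ^ 2 / m) * l ^ 2 = σ ^ 2 / m * (16 * l ^ 2) / 2 := by ring
        _ ≤ σ ^ 2 / m * (m / σ ^ 2) / 2 := by gcongr
        _ = 1 / 2 := by field_simp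
    rw [div_le_iff₀ (by linarith)]
    nlinarith
  -- Chernoff's bound at threshold 3t/2: the moment costs t/2, which leaves exp(-t). Stating it for
  -- both roots l and -l covers both tails.
  have hchern : ∀ l' : ℝ, l' ^ 2 = l ^ 2 →
      (gauss n).real {h | t * (3 / 2) ≤ l' * V h} ≤ Real.exp (-t) := by
    intro l' hl'
    obtain ⟨i1, b1⟩ := integral_exp_standardized_lrt_le hc hK hμ hσ (l := l') (by rwa [hl'])
    rw [hl'] at b1
    have hmk := mul_meas_ge_le_integral_of_nonneg (.of_forall fun h => (Real.exp_pos _).le) i1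
      (Real.exp (t * (3 / 2)))
    have e : {h | Real.exp (t * (3 / 2)) ≤ Real.exp (l' *
        ((lrt K μ₀ σ h - meanLrt K μ₀ σ) / (σ * √(meanErr K μ₀ σ))))} =
        {h | t * (3 / 2) ≤ l' * V h} := by
      ext h; simp only [Set.mem_ofPred_eq, Real.exp_le_exp, V, a, m]
    rw [e] at hmk
    have h1 := hmk.trans (b1.trans hexp)
    rw [← le_div_iff₀' (Real.exp_pos _), ← Real.exp_sub] at h1
    refine h1.trans_eq ?_
    ring_nf
  -- The constant 6 is 4 · 3/2: the choice of l gives 4l(√t + σt/√m) ≥ t, so a deviation six times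
  -- as large puts l|V| above 3t/2.
  have hsub : {h | √(σ ^ 2 * m * t) + σ ^ 2 * t ≤ 6⁻¹ * |lrt K μ₀ σ h - meanLrt K μ₀ σ|} ⊆
      {h | t * (3 / 2) ≤ l * V h} ∪ {h | t * (3 / 2) ≤ -l * V h} := by
    intro h hh
    simp only [Set.mem_ofPred_eq, hsq] at hh
    have hσa : 0 < σ * a := by positivity
    have h1 : 6 * (r + σ * t / a) ≤ |V h| := by
      simp only [V]
      rw [abs_div, abs_of_pos hσa, le_div_iff₀ hσa]
      have e : 6 * (r + σ * t / a) * (σ * a) = 6 * (σ * a * r + σ ^ 2 * t) := by field_simp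
      rw [e]; linarith
    have h2 : t * (3 / 2) ≤ l * |V h| := by
      have := mul_le_mul_of_nonneg_left h1 hl0
      linarith
    rcases abs_cases (V h) with ⟨h3, -⟩ | ⟨h3, -⟩ <;> rw [h3] at h2
    · exact Or.inl h2
    · refine Or.inr ?_
      simp only [Set.mem_ofPred_eq]; linarith
  calc _ ≤ (gauss n).real ({h | t * (3 / 2) ≤ l * V h} ∪ {h | t * (3 / 2) ≤ -l * V h}) :=
        measureReal_mono hsub
    _ ≤ _ := measureReal_union_le _ _
    _ ≤ Real.exp (-t) + Real.exp (-t) :=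
        add_le_add (hchern l rfl) (hchern (-l) (neg_sq l))
    _ = _ := by ring

/-- Standardization is impossible here, but the variance bound makes lrt almost surely constant, so
for t > 0 the event is null; at t = 0 the bound is 1. -/
theorem measureReal_le_of_meanErr_eq_zero {σ : ℝ} (hσ : 0 < σ) (hm : meanErr K μ₀ σ = 0) {t : ℝ}
    (ht : 0 ≤ t) :
    (gauss n).real {h | √(σ ^ 2 * meanErr K μ₀ σ * t) + σ ^ 2 * t ≤
      6⁻¹ * |lrt K μ₀ σ h - meanLrt K μ₀ σ|} ≤ Real.exp (-t) := by
  rcases ht.eq_or_lt with rfl | ht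
  · simp
  have hv : variance (lrt K μ₀ σ) (gauss n) = 0 :=
    le_antisymm (by simpa [hm] using variance_lrt_le hc hK hμ hσ) (variance_nonneg _ _)
  have hae : ∀ᵐ h ∂gauss n, lrt K μ₀ σ h = meanLrt K μ₀ σ := by
    have hsq : Integrable (fun h => (lrt K μ₀ σ h - meanLrt K μ₀ σ) ^ 2) (gauss n) :=
      ((memLp_lrt hc hK hμ σ).sub (memLp_const (meanLrt K μ₀ σ))).integrable_sq
    rw [variance_eq_integral (continuous_lrt hc hK hμ σ).measurable.aemeasurable,
      show ∫ x, lrt K μ₀ σ x ∂gauss n = meanLrt K μ₀ σ from rfl,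
      integral_eq_zero_iff_of_nonneg (fun _ => sq_nonneg _) hsq] at hv
    filter_upwards [hv] with h hh
    exact sub_eq_zero.1 (pow_eq_zero_iff two_ne_zero |>.1 hh)
  have h0 : (gauss n).real {h | √(σ ^ 2 * meanErr K μ₀ σ * t) + σ ^ 2 * t ≤
      6⁻¹ * |lrt K μ₀ σ h - meanLrt K μ₀ σ|} = 0 := by
    rw [measureReal_eq_zero_iff]
    refine measure_mono_null (fun h hh => ?_) (ae_iff.1 hae)
    simp only [Set.mem_ofPred_eq] at hh ⊢
    intro h1
    rw [h1, sub_self, abs_zero, mul_zero] at hh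
    have : 0 < σ ^ 2 * t := by positivity
    linarith [Real.sqrt_nonneg (σ ^ 2 * meanErr K μ₀ σ * t)]
  rw [h0]
  exact (Real.exp_pos _).le

theorem measureReal_lrt_deviation_le {σ : ℝ} (hσ : 0 < σ) {t : ℝ} (ht : 0 ≤ t) :
    (gauss n).real {h | √(σ ^ 2 * meanErr K μ₀ σ * t) + σ ^ 2 * t ≤
      6⁻¹ * |lrt K μ₀ σ h - meanLrt K μ₀ σ|} ≤ 6 * Real.exp (-t / 6) := by
  have h1 : Real.exp (-t) ≤ Real.exp (-t / 6) := Real.exp_le_exp.2 (by linarith)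
  have h0 := Real.exp_pos (-t / 6)
  rcases (meanErr_nonneg K μ₀ σ).eq_or_lt with hm | hm
  · have := measureReal_le_of_meanErr_eq_zero hc hK hμ hσ hm.symm ht
    linarith
  · have := measureReal_le_of_meanErr_pos hc hK hμ hσ hm ht
    linarith

end

end SeqModel

/-! ### Stein's formula for the mean, the pathwise integral formula, and cones -/

namespace SeqModel

variable {n : ℕ} {K : Set (EuclideanSpace ℝ (Fin n))} {μ₀ : EuclideanSpace ℝ (Fin n)}

section

variable (hc : IsClosed K) (hK : Convex ℝ K) (hμ : μ₀ ∈ K)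
include hc hK hμ

theorem ae_differentiableAt_proj {σ : ℝ} (hσ : 0 < σ) :
    ∀ᵐ h ∂gauss n, DifferentiableAt ℝ (proj K) (obs μ₀ σ h) := by
  have h := ae_stdGaussian_comp_smul_add hσ.ne' μ₀
    (lipschitzWith_proj hc hK ⟨μ₀, hμ⟩).ae_differentiableAt
  filter_upwards [h] with x hx
  rwa [obs, add_comm]

theorem lipschitzWith_proj_apply (i : Fin n) : LipschitzWith 1 fun w => proj K w i := by
  refine LipschitzWith.of_dist_le_mul fun x y => ?_
  refine le_trans ?_ ((lipschitzWith_proj hc hK ⟨μ₀, hμ⟩).dist_le_mul x y)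
  rw [dist_eq_norm, dist_eq_norm, ← PiLp.sub_apply]
  exact PiLp.norm_apply_le _ i

theorem divLse_le (σ : ℝ) (h : EuclideanSpace ℝ (Fin n)) : divLse K μ₀ σ h ≤ n := by
  rw [divLse, divergence]
  calc _ ≤ ∑ _i : Fin n, (1 : ℝ) := Finset.sum_le_sum fun i _ => by
        refine (le_abs_self _).trans ((norm_lineDeriv_le_of_lipschitz ℝ
          (lipschitzWith_proj_apply hc hK hμ i)).trans ?_)
        simp
    _ = n := by simp

/-- Stein's identity for the i-th coordinate of the displacement in the i-th direction; the chain
rule through y = μ₀ + σh contributes the factor σ. -/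
theorem integral_lineDeriv_proj_apply {σ : ℝ} (hσ : 0 < σ) (i : Fin n) :
    Integrable (fun h => lineDeriv ℝ (fun w => proj K w i) (obs μ₀ σ h)
      (EuclideanSpace.single i 1)) (gauss n) ∧
    Integrable (fun h => h i * displacement K μ₀ (σ • h) i) (gauss n) ∧
    σ * ∫ h, lineDeriv ℝ (fun w => proj K w i) (obs μ₀ σ h)
      (EuclideanSpace.single i 1) ∂gauss n =
      ∫ h, h i * displacement K μ₀ (σ • h) i ∂gauss n := by
  set ψ : EuclideanSpace ℝ (Fin n) → ℝ := fun h => displacement K μ₀ (σ • h) i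
  set e : EuclideanSpace ℝ (Fin n) := EuclideanSpace.single i 1
  have hψL : ∀ x y, |ψ x - ψ y| ≤ σ * ‖x - y‖ := fun x y => by
    have h1 := (lipschitzWith_proj_apply hc hK hμ i).norm_sub_le (μ₀ + σ • x) (μ₀ + σ • y)
    rw [add_sub_add_left_eq_sub, ← smul_sub, norm_smul, Real.norm_of_nonneg hσ.le,
      NNReal.coe_one, one_mul] at h1
    simpa [ψ, displacement] using h1
  have hψ : ExpLipschitz σ 0 ψ := fun x y => by simpa using hψL x y
  have hd : ∀ᵐ h ∂gauss n, HasFDerivAt ψ (σ • fderiv ℝ (fun w => proj K w i) (obs μ₀ σ h)) h ∧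
      σ * lineDeriv ℝ (fun w => proj K w i) (obs μ₀ σ h) e = fderiv ℝ ψ h e := by
    have h0 := ae_stdGaussian_comp_smul_add hσ.ne' μ₀
      (lipschitzWith_proj_apply hc hK hμ i).ae_differentiableAt
    filter_upwards [h0] with h hh
    rw [show σ • h + μ₀ = obs μ₀ σ h from add_comm _ _] at hh
    have h1 : HasFDerivAt (obs μ₀ σ) (σ • ContinuousLinearMap.id ℝ (EuclideanSpace ℝ (Fin n))) h :=
      ((hasFDerivAt_id h).const_smul σ).const_add μ₀
    have h2 : HasFDerivAt ψ (σ • fderiv ℝ (fun w => proj K w i) (obs μ₀ σ h)) h := by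
      refine ((hh.hasFDerivAt.comp h h1).sub_const (μ₀ i)).congr_fderiv ?_
      ext; simp
    refine ⟨h2, ?_⟩
    rw [h2.fderiv, hh.lineDeriv_eq_fderiv, smul_apply, smul_eq_mul]
  have hst := integral_inner_mul_stdGaussian hσ.le le_rfl hψ
    (hd.mono fun h hh => hh.1.differentiableAt) e
  have hin : ∀ h : EuclideanSpace ℝ (Fin n), ⟪e, h⟫ = h i := fun h => by
    simp [e, EuclideanSpace.inner_single_left]
  simp only [hin] at hst
  have hfi : Integrable (fun h => fderiv ℝ ψ h e) (gauss n) := by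
    refine Integrable.of_bound (measurable_fderiv_apply_const ℝ ψ e).aestronglyMeasurable
      (σ * ‖e‖) (.of_forall fun h => ?_)
    refine (ContinuousLinearMap.le_opNorm _ _).trans ?_
    gcongr
    refine norm_fderiv_le_of_lip' ℝ hσ.le (.of_forall fun y => hψL y h)
  refine ⟨?_, ?_, ?_⟩
  · refine (hfi.const_mul σ⁻¹).congr ?_
    filter_upwards [hd] with h hh
    rw [← hh.2, inv_mul_cancel_left₀ hσ.ne']
  · have hb : Integrable (fun h : EuclideanSpace ℝ (Fin n) => σ⁻¹ * (σ ^ 2 * ‖h‖ ^ 2)) (gauss n) :=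
      (integrable_sq_mul_norm_sq σ).const_mul σ⁻¹
    refine hb.mono' ?_ (.of_forall fun h => ?_)
    · have h1 : Continuous fun h : EuclideanSpace ℝ (Fin n) => h i := by fun_prop
      exact (h1.mul hψ.continuous).aestronglyMeasurable
    · have h1 : ‖h i‖ ≤ ‖h‖ := PiLp.norm_apply_le h i
      have h2 : ‖ψ h‖ ≤ σ * ‖h‖ := by
        refine (PiLp.norm_apply_le (displacement K μ₀ (σ • h)) i).trans
          ((norm_displacement_le hc hK hμ _).trans_eq ?_)
        rw [norm_smul, Real.norm_of_nonneg hσ.le]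
      rw [norm_mul]
      calc _ ≤ ‖h‖ * (σ * ‖h‖) := by gcongr
        _ = _ := by field_simp
  · rw [← integral_const_mul]
    refine (integral_congr_ae ?_).trans hst.symm
    filter_upwards [hd] with h hh
    exact hh.2

theorem integrable_divLse {σ : ℝ} (hσ : 0 < σ) : Integrable (divLse K μ₀ σ) (gauss n) :=
  integrable_finsetSum Finset.univ fun i _ => (integral_lineDeriv_proj_apply hc hK hμ hσ i).1

/-- Stein's formula for the mean of the likelihood ratio statistic. -/
theorem meanLrt_eq {σ : ℝ} (hσ : 0 < σ) :
    meanLrt K μ₀ σ = 2 * σ ^ 2 * ∫ h, divLse K μ₀ σ h ∂gauss n - meanErr K μ₀ σ := by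
  have h1 : σ * ∫ h, divLse K μ₀ σ h ∂gauss n =
      ∫ h, ⟪h, displacement K μ₀ (σ • h)⟫ ∂gauss n := by
    simp only [divLse, divergence]
    rw [integral_finsetSum _ fun i _ => (integral_lineDeriv_proj_apply hc hK hμ hσ i).1,
      Finset.mul_sum]
    simp only [(integral_lineDeriv_proj_apply hc hK hμ hσ _).2.2]
    rw [← integral_finsetSum _ fun i _ => (integral_lineDeriv_proj_apply hc hK hμ hσ i).2.1]
    refine integral_congr_ae (.of_forall fun h => ?_)
    simp [PiLp.inner_apply, mul_comm]
  have h2 : ∀ h, lrt K μ₀ σ h + err K μ₀ σ h = 2 * σ * ⟪h, displacement K μ₀ (σ • h)⟫ :=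
    fun h => by rw [lrt_eq, err_eq, excess, real_inner_smul_left]; ring
  have h3 : meanLrt K μ₀ σ + meanErr K μ₀ σ = 2 * σ * (σ * ∫ h, divLse K μ₀ σ h ∂gauss n) := by
    rw [meanLrt, meanErr, ← integral_add (integrable_lrt hc hK hμ σ) (integrable_err hc hK hμ σ),
      h1, ← integral_const_mul]
    exact integral_congr_ae (.of_forall h2)
  linarith

theorem abs_err_div_sq_le (h : EuclideanSpace ℝ (Fin n)) (τ : ℝ) :
    |err K μ₀ τ h / τ ^ 2| ≤ ‖h‖ ^ 2 := by
  rcases eq_or_ne τ 0 with rfl | hτ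
  · simp
  rw [abs_div, abs_of_pos (by positivity : 0 < τ ^ 2), div_le_iff₀ (by positivity), mul_comm]
  exact abs_err_le hc hK hμ τ h

theorem intervalIntegrable_err_div_sq (h : EuclideanSpace ℝ (Fin n)) (a b : ℝ) :
    IntervalIntegrable (fun τ : ℝ => err K μ₀ τ h / τ ^ 2) volume a b := by
  refine (intervalIntegrable_const (c := ‖h‖ ^ 2)).mono_fun ?_ (.of_forall fun τ => ?_)
  · have h1 : Continuous fun τ : ℝ => err K μ₀ τ h := by
      simp only [err_eq]
      exact ((continuous_displacement hc hK hμ).comp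
        (continuous_id.smul continuous_const)).norm.pow 2
    exact (h1.measurable.div (by fun_prop)).aestronglyMeasurable
  · rw [Real.norm_of_nonneg (sq_nonneg _)]
    exact abs_err_div_sq_le hc hK hμ h τ

/-- Along a ray the likelihood ratio statistic is an average of rescaled squared errors. -/
theorem lrt_eq_mul_integral {σ : ℝ} (hσ : 0 < σ) (h : EuclideanSpace ℝ (Fin n)) :
    lrt K μ₀ σ h = σ * ∫ τ in (0 : ℝ)..σ, err K μ₀ τ h / τ ^ 2 := by
  have hcont : Continuous fun τ : ℝ => lrt K μ₀ τ h := by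
    simp only [lrt_eq]
    exact (continuous_excess hc hK hμ).comp (continuous_id.smul continuous_const)
  -- At τ = 0 the quotient has the default value 0, which is also its limit because |lrt(τ)| ≤
  -- τ²‖h‖².
  have hco : ContinuousOn (fun τ : ℝ => lrt K μ₀ τ h / τ) (Set.Icc 0 σ) := by
    intro τ hτ
    rcases hτ.1.eq_or_lt with rfl | hτ0
    · refine ContinuousAt.continuousWithinAt ?_
      rw [ContinuousAt, div_zero]
      refine squeeze_zero_norm (a := fun τ : ℝ => |τ| * ‖h‖ ^ 2) (fun τ => ?_) ?_
      · rcases eq_or_ne τ 0 with rfl | h0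
        · simp
        rw [norm_div, div_le_iff₀ (norm_pos_iff.2 h0), Real.norm_eq_abs, Real.norm_eq_abs]
        refine (abs_lrt_le hc hK hμ τ h).trans_eq ?_
        rw [← sq_abs τ]; ring
      · have : Continuous fun τ : ℝ => |τ| * ‖h‖ ^ 2 := by fun_prop
        simpa using this.tendsto 0
    · exact (hcont.continuousAt.div continuousAt_id hτ0.ne').continuousWithinAt
  have hder : ∀ τ ∈ Set.Ioo 0 σ,
      HasDerivAt (fun τ : ℝ => lrt K μ₀ τ h / τ) (err K μ₀ τ h / τ ^ 2) τ := fun τ hτ => by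
    have h1 : HasDerivAt (fun τ : ℝ => τ • h) ((1 : ℝ) • h) τ := (hasDerivAt_id τ).smul_const h
    have h2 := (hasFDerivAt_excess hc hK hμ (τ • h)).comp_hasDerivAt τ h1
    have h3 : HasDerivAt (fun τ : ℝ => lrt K μ₀ τ h) (2 * ⟪h, displacement K μ₀ (τ • h)⟫) τ := by
      simp only [lrt_eq]
      refine h2.congr_deriv ?_
      rw [one_smul, smul_apply, innerSL_apply_apply ℝ, smul_eq_mul, real_inner_comm]
    refine (h3.div (hasDerivAt_id τ) hτ.1.ne').congr_deriv ?_
    rw [id, lrt_eq, err_eq, excess, real_inner_smul_left]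
    ring
  rw [intervalIntegral.integral_eq_sub_of_hasDerivAt_of_le hσ.le hco hder
    (intervalIntegrable_err_div_sq hc hK hμ h 0 σ), div_zero, sub_zero, mul_div_cancel₀ _ hσ.ne']

theorem err_le_lrt (σ : ℝ) (h : EuclideanSpace ℝ (Fin n)) : err K μ₀ σ h ≤ lrt K μ₀ σ h := by
  rw [lrt_eq, err_eq]; exact norm_displacement_sq_le_excess hc hK hμ _

theorem lrt_le_err_add_integral {σ : ℝ} (hσ : 0 < σ) (h : EuclideanSpace ℝ (Fin n)) :
    lrt K μ₀ σ h ≤ err K μ₀ σ h + 2 * σ *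
      ∫ τ in (0 : ℝ)..σ, (err K μ₀ τ h / τ ^ 2 - err K μ₀ σ h / σ ^ 2) := by
  rw [intervalIntegral.integral_sub (intervalIntegrable_err_div_sq hc hK hμ h 0 σ)
    intervalIntegrable_const, intervalIntegral.integral_const, sub_zero, smul_eq_mul, mul_sub,
    mul_assoc 2, ← lrt_eq_mul_integral hc hK hμ hσ]
  -- By the integral formula the right side of the goal equals 2 lrt - err, so the claim reduces to
  -- err ≤ lrt.
  have e : 2 * σ * (σ * (err K μ₀ σ h / σ ^ 2)) = 2 * err K μ₀ σ h := by field_simp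
  linarith [err_le_lrt hc hK hμ σ h]

omit hc hK hμ in
theorem lrt_eq_err_add (σ : ℝ) (h : EuclideanSpace ℝ (Fin n)) :
    lrt K μ₀ σ h = err K μ₀ σ h +
      2 * ⟪lse K μ₀ σ h - μ₀ - σ • h, μ₀ - lse K μ₀ σ h⟫ := by
  have e : lse K μ₀ σ h - μ₀ = displacement K μ₀ (σ • h) := rfl
  rw [← neg_sub (lse K μ₀ σ h) μ₀, e, lrt_eq, err_eq, excess, inner_neg_right, inner_sub_left,
    real_inner_self_eq_norm_sq]
  ring

omit hc hμ in
theorem add_mem_of_cone (hcone : ∀ c : ℝ, 0 < c → ∀ x ∈ K, c • x ∈ K)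
    {x y : EuclideanSpace ℝ (Fin n)} (hx : x ∈ K) (hy : y ∈ K) : x + y ∈ K := by
  have h := hcone 2 two_pos _ (hK hx hy (a := 1 / 2) (b := 1 / 2) (by norm_num) (by norm_num)
    (by norm_num))
  rwa [← smul_add, smul_smul, mul_one_div_cancel two_ne_zero, one_smul] at h

omit hK in
-- Only positive scalars are allowed in the cone condition, so the apex is obtained from closedness
-- by letting c tend to 0.
theorem zero_mem_of_cone (hcone : ∀ c : ℝ, 0 < c → ∀ x ∈ K, c • x ∈ K) :
    (0 : EuclideanSpace ℝ (Fin n)) ∈ K := by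
  have h : Filter.Tendsto (fun c : ℝ => c • μ₀) (nhdsWithin 0 (Set.Ioi 0)) (nhds 0) := by
    have : Continuous fun c : ℝ => c • μ₀ := by fun_prop
    have h := this.tendsto 0
    rw [zero_smul] at h
    exact h.mono_left nhdsWithin_le_nhds
  refine hc.mem_of_tendsto h ?_
  filter_upwards [self_mem_nhdsWithin] with c hc0
  exact hcone c hc0 _ hμ

theorem lse_mem (σ : ℝ) (h : EuclideanSpace ℝ (Fin n)) : lse K μ₀ σ h ∈ K :=
  (isLeastSquares_proj hc hK ⟨μ₀, hμ⟩ _).1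

theorem lrt_le_of_cone (hcone : ∀ c : ℝ, 0 < c → ∀ x ∈ K, c • x ∈ K) (σ : ℝ)
    (h ν : EuclideanSpace ℝ (Fin n)) (hν : lse K μ₀ σ h - ν ∈ K) :
    lrt K μ₀ σ h ≤ err K μ₀ σ h + 2 * ⟪lse K μ₀ σ h - μ₀ - σ • h, μ₀ - ν⟫ := by
  -- Tested at μ̂ + (μ̂ - ν), which the cone contains as a sum of two of its elements, the
  -- obtuse-angle inequality reads ⟨y - μ̂, μ̂ - ν⟩ ≤ 0. This is exactly the gap between ν and the
  -- equality case ν = μ̂.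
  have h1 := inner_sub_proj_le_zero hc hK
    (add_mem_of_cone hK hcone (lse_mem hc hK hμ σ h) hν) (obs μ₀ σ h)
  rw [show proj K (obs μ₀ σ h) = lse K μ₀ σ h from rfl, add_sub_cancel_left] at h1
  have e1 : lse K μ₀ σ h - μ₀ - σ • h = -(obs μ₀ σ h - lse K μ₀ σ h) := by rw [obs]; abel
  have e2 : μ₀ - ν = (μ₀ - lse K μ₀ σ h) + (lse K μ₀ σ h - ν) := by abel
  rw [lrt_eq_err_add σ h, e2, inner_add_right, e1, inner_neg_left, inner_neg_left]
  linarith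

end

end SeqModel

/-! ### The full statement -/

theorem proposition4p6 :
    (∀ (n : ℕ) (K : Set (EuclideanSpace ℝ (Fin n))) (μ₀ : EuclideanSpace ℝ (Fin n)) (σ : ℝ),
      IsClosed K → Convex ℝ K → μ₀ ∈ K → 0 < σ →
      -- the expectations that occur below exist, and so does the divergence almost surely
      (Integrable (SeqModel.err K μ₀ σ) (SeqModel.gauss n) ∧
        Integrable (SeqModel.lrt K μ₀ σ) (SeqModel.gauss n) ∧
        Integrable (SeqModel.divLse K μ₀ σ) (SeqModel.gauss n) ∧
        ∀ᵐ h ∂SeqModel.gauss n,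
          DifferentiableAt ℝ (SeqModel.proj K) (SeqModel.obs μ₀ σ h)) ∧
      -- (1) bounds on the mean
      (SeqModel.meanLrt K μ₀ σ ≤ 2 * σ ^ 2 * ∫ h, SeqModel.divLse K μ₀ σ h ∂SeqModel.gauss n) ∧
      (2 * σ ^ 2 * ∫ h, SeqModel.divLse K μ₀ σ h ∂SeqModel.gauss n ≤ 2 * σ ^ 2 * n) ∧
      -- (2) pathwise comparison with the squared error
      (∀ h : EuclideanSpace ℝ (Fin n),
        SeqModel.err K μ₀ σ h ≤ SeqModel.lrt K μ₀ σ h ∧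
        IntervalIntegrable
          (fun τ : ℝ => SeqModel.err K μ₀ τ h / τ ^ 2 - SeqModel.err K μ₀ σ h / σ ^ 2)
          volume 0 σ ∧
        SeqModel.lrt K μ₀ σ h ≤ SeqModel.err K μ₀ σ h + 2 * σ *
          ∫ τ in (0 : ℝ)..σ,
            (SeqModel.err K μ₀ τ h / τ ^ 2 - SeqModel.err K μ₀ σ h / σ ^ 2)) ∧
      -- (2) for cones; `ν` is chosen after `h`, so it may be random
      ((∀ c : ℝ, 0 < c → ∀ x ∈ K, c • x ∈ K) →
        ∀ h : EuclideanSpace ℝ (Fin n),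
          (∀ ν : EuclideanSpace ℝ (Fin n),
            (∀ x ∈ K, x + ν ∈ K) → SeqModel.lse K μ₀ σ h - ν ∈ K →
            SeqModel.err K μ₀ σ h ≤ SeqModel.lrt K μ₀ σ h ∧
            SeqModel.lrt K μ₀ σ h ≤ SeqModel.err K μ₀ σ h +
              2 * inner ℝ (SeqModel.lse K μ₀ σ h - μ₀ - σ • h) (μ₀ - ν)) ∧
          -- `ν = μ̂_K(σ)` is admissible and gives equality
          (∀ x ∈ K, x + SeqModel.lse K μ₀ σ h ∈ K) ∧
          SeqModel.lse K μ₀ σ h - SeqModel.lse K μ₀ σ h ∈ K ∧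
          SeqModel.lrt K μ₀ σ h = SeqModel.err K μ₀ σ h +
            2 * inner ℝ (SeqModel.lse K μ₀ σ h - μ₀ - σ • h) (μ₀ - SeqModel.lse K μ₀ σ h)) ∧
      -- (3) variance bound
      (MemLp (SeqModel.lrt K μ₀ σ) 2 (SeqModel.gauss n) ∧
        variance (SeqModel.lrt K μ₀ σ) (SeqModel.gauss n) ≤
          4 * σ ^ 2 * SeqModel.meanErr K μ₀ σ) ∧
      -- (4) exponential moment bound
      (∀ l : ℝ, l ^ 2 < SeqModel.meanErr K μ₀ σ / (8 * σ ^ 2) →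
        Integrable (fun h => Real.exp (l * ((SeqModel.lrt K μ₀ σ h - SeqModel.meanLrt K μ₀ σ) /
          (σ * √(SeqModel.meanErr K μ₀ σ))))) (SeqModel.gauss n) ∧
        ∫ h, Real.exp (l * ((SeqModel.lrt K μ₀ σ h - SeqModel.meanLrt K μ₀ σ) /
            (σ * √(SeqModel.meanErr K μ₀ σ)))) ∂SeqModel.gauss n ≤
          Real.exp (4 * l ^ 2 / (1 - 8 * (σ ^ 2 / SeqModel.meanErr K μ₀ σ) * l ^ 2)))) ∧
    -- (4) tail bound, with an absolute constant
    (∃ L : ℝ, 0 < L ∧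
      ∀ (n : ℕ) (K : Set (EuclideanSpace ℝ (Fin n))) (μ₀ : EuclideanSpace ℝ (Fin n)) (σ : ℝ),
        IsClosed K → Convex ℝ K → μ₀ ∈ K → 0 < σ → ∀ t : ℝ, 0 ≤ t →
        (SeqModel.gauss n).real
            {h | √(σ ^ 2 * SeqModel.meanErr K μ₀ σ * t) + σ ^ 2 * t ≤
              L⁻¹ * |SeqModel.lrt K μ₀ σ h - SeqModel.meanLrt K μ₀ σ|} ≤
          L * Real.exp (-t / L)) := by

  refine ⟨fun n K μ₀ σ hc hK hμ hσ => ⟨⟨SeqModel.integrable_err hc hK hμ σ,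
    SeqModel.integrable_lrt hc hK hμ σ, SeqModel.integrable_divLse hc hK hμ hσ,
    SeqModel.ae_differentiableAt_proj hc hK hμ hσ⟩, ?_, ?_, fun h =>
    ⟨SeqModel.err_le_lrt hc hK hμ σ h,
      (SeqModel.intervalIntegrable_err_div_sq hc hK hμ h 0 σ).sub intervalIntegrable_const,
      SeqModel.lrt_le_err_add_integral hc hK hμ hσ h⟩, fun hcone h => ⟨fun ν _ hν =>
      ⟨SeqModel.err_le_lrt hc hK hμ σ h, SeqModel.lrt_le_of_cone hc hK hμ hcone σ h ν hν⟩,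
      fun x hx => SeqModel.add_mem_of_cone hK hcone hx (SeqModel.lse_mem hc hK hμ σ h), ?_,
      SeqModel.lrt_eq_err_add σ h⟩,
    ⟨SeqModel.memLp_lrt hc hK hμ σ, SeqModel.variance_lrt_le hc hK hμ hσ⟩,
    fun l hl => SeqModel.integral_exp_standardized_lrt_le hc hK hμ hσ hl⟩,
    6, by norm_num, fun n K μ₀ σ hc hK hμ hσ t ht =>
      SeqModel.measureReal_lrt_deviation_le hc hK hμ hσ ht⟩
  · linarith [SeqModel.meanLrt_eq hc hK hμ hσ, SeqModel.meanErr_nonneg K μ₀ σ]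
  · refine mul_le_mul_of_nonneg_left ?_ (by positivity)
    refine (integral_mono (SeqModel.integrable_divLse hc hK hμ hσ) (integrable_const (n : ℝ))
      fun h => SeqModel.divLse_le hc hK hμ σ h).trans_eq ?_
    simp
  · rw [sub_self]
    exact SeqModel.zero_mem_of_cone hc hμ hcone
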